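/- Let $G$ be a connected, simply connected nilpotent real Lie group, $\Gamma\subset G$ a discrete co-compact subgroup, and $N=\Gamma\backslash G$ the corresponding nilmanifold (the quotient by left translations). Let $(\mathcal I,\mathcal J,\mathcal K)$ be a left-invariant hypercomplex structure on $G$, that is, a triple of integrable complex structures with $\mathcal I\mathcal J=-\mathcal J\mathcal I=\mathcal K$ for which all left translations are holomorphic, and equip $N$ with the induced hypercomplex structure, for which the projection $G\to N$ is holomorphic ($N$ is then called a hypercomplex nilmanifold). Let $\nabla$ be the Obata connection of $N$, the unique torsion-free connection on $TN$ with $\nabla\mathcal I=\nabla\mathcal J=\nabla\mathcal K=0$, and let $4n=\dim_{\mathbb R}N$. For a real vector space $V$ of dimension $4n$ with a quaternionic structure $(I,J,K)$, let $GL(n,\mathbb H)$ be the group of real automorphisms of $V$ that commute with $I,J,K$, let $V^{1,0}\subset V\otimes_{\mathbb R}\mathbb C$ be the $\sqrt{-1}$-eigenspace of $I$, and let $\det(h)$ be the scalar by which $h\in GL(n,\mathbb H)$ acts on $\Lambda^{2n}(V^{1,0})\cong\mathbb C$; set $SL(n,\mathbb H)=\ker(\det)\subset GL(n,\mathbb H)$.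 Then, for every $x\in N$, the holonomy group $\operatorname{Hol}_x(\nabla)$, formed by the parallel transports of $\nabla$ around piecewise $C^1$ loops based at $x$, is contained in $SL(n,\mathbb H)$, taken in $V=T_xN$ with the operators $\mathcal I_x,\mathcal J_x,\mathcal K_x$. -/

import Mathlib

open Set Filter Topology
open scoped Manifold ContDiff TensorProduct

section LeftQuotient

variable {G : Type*} [Group G]

/-- The set `Γ \ G` of orbits of the left translation action of a subgroup `Γ` on `G`. -/
def LeftQuotient (Γ : Subgroup G) : Type _ := MulAction.orbitRel.Quotient Γ G

/-- The canonical projection `G → Γ \ G`. -/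
def LeftQuotient.mk (Γ : Subgroup G) : G → LeftQuotient Γ := Quotient.mk (MulAction.orbitRel Γ G)

lemma LeftQuotient.mk_surjective (Γ : Subgroup G) : Function.Surjective (LeftQuotient.mk Γ) :=
  Quotient.mk_surjective

lemma LeftQuotient.mk_eq_mk_iff {Γ : Subgroup G} {x y : G} :
    LeftQuotient.mk Γ x = LeftQuotient.mk Γ y ↔ ∃ γ ∈ Γ, γ * y = x := by
  rw [show (LeftQuotient.mk Γ x = LeftQuotient.mk Γ y ↔ _) from Quotient.eq,
    MulAction.orbitRel_apply, MulAction.mem_orbit_iff]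
  exact ⟨fun ⟨γ, h⟩ => ⟨γ, γ.2, h⟩, fun ⟨γ, hγ, h⟩ => ⟨⟨γ, hγ⟩, h⟩⟩

/-- The quotient topology on `Γ \ G`. -/
instance LeftQuotient.instTopologicalSpace [TopologicalSpace G] (Γ : Subgroup G) : TopologicalSpace (LeftQuotient Γ) :=
  inferInstanceAs (TopologicalSpace (Quotient (MulAction.orbitRel Γ G)))

lemma LeftQuotient.isLocalHomeomorph_mk [TopologicalSpace G] [IsTopologicalGroup G]
    (Γ : Subgroup G) [DiscreteTopology Γ] : IsLocalHomeomorph (LeftQuotient.mk Γ) := by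
  have hq : IsQuotientMap (LeftQuotient.mk Γ) := isQuotientMap_quotient_mk'
  have hd : IsDiscrete (Γ : Set G) := isDiscrete_iff_discreteTopology.mpr ‹_›
  refine (hq.isQuotientCoveringMap_of_subgroup Γ hd ?_).isCoveringMap.isLocalHomeomorph
  intro x y
  rw [eq_comm, LeftQuotient.mk_eq_mk_iff]
  constructor
  · rintro ⟨γ, hγ, rfl⟩; simpa using hγ
  · intro h; exact ⟨_, h, by simp⟩

variable {E : Type*} [NormedAddCommGroup E] [NormedSpace ℝ E]
  [TopologicalSpace G] [ChartedSpace E G] [LieGroup 𝓘(ℝ, E) ∞ G]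

/-- For a discrete subgroup `Γ` of a Lie group `G`, the charts of `Γ \ G` are the local inverses
of the projection `G → Γ \ G` followed by the charts of `G`. -/
noncomputable instance LeftQuotient.instChartedSpace (Γ : Subgroup G) [DiscreteTopology Γ] :
    ChartedSpace E (LeftQuotient Γ) :=
  haveI : IsTopologicalGroup G := topologicalGroup_of_lieGroup 𝓘(ℝ, E) ∞
  (LeftQuotient.isLocalHomeomorph_mk Γ).chartedSpace (LeftQuotient.mk_surjective Γ)

instance LeftQuotient.instIsManifold (Γ : Subgroup G) [DiscreteTopology Γ] :
    IsManifold 𝓘(ℝ, E) ∞ (LeftQuotient Γ) := by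
  have : IsTopologicalGroup G := topologicalGroup_of_lieGroup 𝓘(ℝ, E) ∞
  have hπ := LeftQuotient.isLocalHomeomorph_mk Γ
  refine isManifold_of_contDiffOn _ _ _ ?_
  rintro _ _ ⟨p, rfl⟩ ⟨q, rfl⟩
  set a := (LeftQuotient.mk_surjective Γ).hasRightInverse.choose p
  set b := (LeftQuotient.mk_surjective Γ).hasRightInverse.choose q
  have hLa := hπ.localInverseAt_symm (x := a)
  have hLb := hπ.localInverseAt_symm (x := b)
  set La := hπ.localInverseAt a
  set Lb := hπ.localInverseAt b
  intro x hx
  simp only [modelWithCornersSelf_coe, modelWithCornersSelf_coe_symm, range_id, inter_univ,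
    preimage_id] at hx
  simp [hLa] at hx
  obtain ⟨⟨hx1, hx2⟩, hx3, hx4⟩ := hx
  set y := (chartAt E a).symm x with hy
  obtain ⟨γ, hγ, hγy⟩ : ∃ γ ∈ Γ, γ * y = Lb (LeftQuotient.mk Γ y) := by
    rw [← LeftQuotient.mk_eq_mk_iff]
    exact hπ.apply_localInverseAt_of_mem hx3
  have hc : ContMDiffAt 𝓘(ℝ, E) 𝓘(ℝ, E) ∞ (chartAt E a).symm x :=
    (contMDiffOn_chart_symm (I := 𝓘(ℝ, E)) (n := ∞) (x := a)).contMDiffAt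
      ((chartAt E a).open_target.mem_nhds hx1)
  have hm : ContMDiffAt 𝓘(ℝ, E) 𝓘(ℝ, E) ∞ (fun x' => γ * (chartAt E a).symm x') x :=
    contMDiffAt_const.mul hc
  have key : ∀ᶠ x' in 𝓝 x, Lb (LeftQuotient.mk Γ ((chartAt E a).symm x')) =
      γ * (chartAt E a).symm x' := by
    have h2 : ∀ᶠ z in 𝓝 (γ * y), z ∈ Lb.target := by
      rw [hγy]; exact Lb.open_target.mem_nhds (Lb.map_source hx3)
    filter_upwards [hm.continuousAt.eventually h2] with x' hx'
    have h3 := Lb.right_inv hx'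
    rw [hLb] at h3
    rw [← h3]
    congr 1
    exact (LeftQuotient.mk_eq_mk_iff.mpr ⟨γ, hγ, rfl⟩).symm
  have hb : ContMDiffAt 𝓘(ℝ, E) 𝓘(ℝ, E) ∞ (chartAt E b) (γ * y) :=
    (contMDiffOn_chart (I := 𝓘(ℝ, E)) (n := ∞) (x := b)).contMDiffAt
      ((chartAt E b).open_source.mem_nhds (by rw [hγy]; exact hx4))
  have hfin : ContMDiffAt 𝓘(ℝ, E) 𝓘(ℝ, E) ∞
      (fun x' => chartAt E b (γ * (chartAt E a).symm x')) x := hb.comp x hm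
  refine ContDiffAt.contDiffWithinAt ?_
  refine (contMDiffAt_iff_contDiffAt.mp hfin).congr_of_eventuallyEq ?_
  filter_upwards [key] with x' hx'
  simp [hLa, hx', a, b, La, Lb] at hx' ⊢

/-- The smooth structure on `Γ \ G` is the quotient one: the projection is a local
diffeomorphism. -/
lemma LeftQuotient.isLocalDiffeomorph_mk (Γ : Subgroup G) [DiscreteTopology Γ] :
    IsLocalDiffeomorph 𝓘(ℝ, E) 𝓘(ℝ, E) ∞ (LeftQuotient.mk Γ) := by
  have : IsTopologicalGroup G := topologicalGroup_of_lieGroup 𝓘(ℝ, E) ∞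
  have hπ := LeftQuotient.isLocalHomeomorph_mk Γ
  have hg := (LeftQuotient.mk_surjective Γ).hasRightInverse.choose_spec
  intro x
  set a := (LeftQuotient.mk_surjective Γ).hasRightInverse.choose (LeftQuotient.mk Γ x) with ha
  have hax : LeftQuotient.mk Γ a = LeftQuotient.mk Γ x := hg _
  obtain ⟨γ, hγ, hγx⟩ := LeftQuotient.mk_eq_mk_iff.mp hax
  have h1 : IsLocalDiffeomorphAt 𝓘(ℝ, E) 𝓘(ℝ, E) ∞ (LeftQuotient.mk Γ) (γ * x) := by
    rw [hγx]
    have hLa := hπ.localInverseAt_symm (x := a)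
    have hca : chartAt E (LeftQuotient.mk Γ x) = (hπ.localInverseAt a).trans (chartAt E a) := rfl
    let e := (chartAt E a).trans (chartAt E (LeftQuotient.mk Γ x)).symm
    refine ⟨⟨e.toPartialEquiv, e.open_source, e.open_target, ?_, ?_⟩, ?_, ?_⟩
    · exact contMDiffOn_chart_symm.comp (contMDiffOn_chart.mono inter_subset_left)
        inter_subset_right
    · exact contMDiffOn_chart_symm.comp (contMDiffOn_chart.mono inter_subset_left)
        inter_subset_right
    · simp [e, hca]
    · intro y hy
      simp [e, hca] at hy
      simp [e, hca, hLa, hy.1]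
  have h2 : IsLocalDiffeomorphAt 𝓘(ℝ, E) 𝓘(ℝ, E) ∞ (fun y : G => γ * y) x := by
    let Φ : G ≃ₘ^∞⟮𝓘(ℝ, E), 𝓘(ℝ, E)⟯ G :=
      { Equiv.mulLeft γ with
        contMDiff_toFun := contMDiff_mul_left
        contMDiff_invFun := contMDiff_mul_left }
    exact Φ.isLocalDiffeomorph x
  have h3 := h2.comp 𝓘(ℝ, E) _ h1
  have h4 : LeftQuotient.mk Γ ∘ (fun y : G => γ * y) = LeftQuotient.mk Γ :=
    funext fun y => LeftQuotient.mk_eq_mk_iff.mpr ⟨γ, hγ, rfl⟩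
  rwa [h4] at h3

end LeftQuotient

section Geometry

open Bundle VectorField

variable {E : Type*} [NormedAddCommGroup E] [NormedSpace ℝ E]
  {M : Type*} [TopologicalSpace M] [ChartedSpace E M] [IsManifold 𝓘(ℝ, E) ∞ M]
  {M' : Type*} [TopologicalSpace M'] [ChartedSpace E M'] [IsManifold 𝓘(ℝ, E) ∞ M']

/-- A smooth vector field on `M`. -/
def IsSmoothVectorField (X : (x : M) → TangentSpace 𝓘(ℝ, E) x) : Prop :=
  ContMDiff 𝓘(ℝ, E) 𝓘(ℝ, E).tangent ∞ (fun x => (⟨x, X x⟩ : TangentBundle 𝓘(ℝ, E) M))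

/-- A smooth section `A` of `End(TM)` is an integrable complex structure if `A² = -1` and its
Nijenhuis tensor `[AX, AY] - A[AX, Y] - A[X, AY] - [X, Y]` vanishes. -/
structure IsComplexStructure
    (A : (x : M) → TangentSpace 𝓘(ℝ, E) x →L[ℝ] TangentSpace 𝓘(ℝ, E) x) : Prop where
  smooth : ContMDiff 𝓘(ℝ, E) (𝓘(ℝ, E).prod 𝓘(ℝ, E →L[ℝ] E)) ∞
    (fun x => TotalSpace.mk' (E →L[ℝ] E)
      (E := fun x : M => TangentSpace 𝓘(ℝ, E) x →L[ℝ] TangentSpace 𝓘(ℝ, E) x) x (A x))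
  sq : ∀ x v, A x (A x v) = -v
  integrable : ∀ X Y : (x : M) → TangentSpace 𝓘(ℝ, E) x,
    IsSmoothVectorField X → IsSmoothVectorField Y → ∀ x,
      mlieBracket 𝓘(ℝ, E) (fun y => A y (X y)) (fun y => A y (Y y)) x
        - A x (mlieBracket 𝓘(ℝ, E) (fun y => A y (X y)) Y x)
        - A x (mlieBracket 𝓘(ℝ, E) X (fun y => A y (Y y)) x)
        - mlieBracket 𝓘(ℝ, E) X Y x = 0

variable (E M) in
/-- A hypercomplex structure on a smooth manifold: three integrable complex structures with
`IJ = -JI = K`. -/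
structure HypercomplexStructure where
  I : (x : M) → TangentSpace 𝓘(ℝ, E) x →L[ℝ] TangentSpace 𝓘(ℝ, E) x
  J : (x : M) → TangentSpace 𝓘(ℝ, E) x →L[ℝ] TangentSpace 𝓘(ℝ, E) x
  K : (x : M) → TangentSpace 𝓘(ℝ, E) x →L[ℝ] TangentSpace 𝓘(ℝ, E) x
  isComplexStructure_I : IsComplexStructure I
  isComplexStructure_J : IsComplexStructure J
  isComplexStructure_K : IsComplexStructure K
  I_J : ∀ x v, I x (J x v) = K x v
  J_I : ∀ x v, J x (I x v) = -K x v

/-- The map `f` is holomorphic with respect to `A` and `B`: it is smooth and `df ∘ A = B ∘ df`. -/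
def IsHolomorphicMap (f : M → M')
    (A : (x : M) → TangentSpace 𝓘(ℝ, E) x →L[ℝ] TangentSpace 𝓘(ℝ, E) x)
    (B : (y : M') → TangentSpace 𝓘(ℝ, E) y →L[ℝ] TangentSpace 𝓘(ℝ, E) y) : Prop :=
  ContMDiff 𝓘(ℝ, E) 𝓘(ℝ, E) ∞ f ∧ ∀ x (v : TangentSpace 𝓘(ℝ, E) x),
    mfderiv 𝓘(ℝ, E) 𝓘(ℝ, E) f x (A x v) = B (f x) (mfderiv 𝓘(ℝ, E) 𝓘(ℝ, E) f x v)

/-- The map `f` is holomorphic for each of the complex structures of `S` and `S'`. -/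
structure HypercomplexStructure.IsHypercomplexMap
    (S : HypercomplexStructure E M)
    (S' : HypercomplexStructure E M') (f : M → M') : Prop where
  map_I : IsHolomorphicMap f S.I S'.I
  map_J : IsHolomorphicMap f S.J S'.J
  map_K : IsHolomorphicMap f S.K S'.K

/-- Left translations are holomorphic with respect to the three complex structures. -/
def HypercomplexStructure.IsLeftInvariant {G : Type*} [Group G] [TopologicalSpace G]
    [ChartedSpace E G] [IsManifold 𝓘(ℝ, E) ∞ G] (S : HypercomplexStructure E G) : Prop :=
  ∀ g : G, S.IsHypercomplexMap S (fun x => g * x)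

/-- `∇A = 0` for a section `A` of `End(TM)`, that is, `∇_X (A Y) = A (∇_X Y)`. -/
def IsParallelTensor (nabla : CovariantDerivative 𝓘(ℝ, E) E (TangentSpace 𝓘(ℝ, E) : M → Type _))
    (A : (x : M) → TangentSpace 𝓘(ℝ, E) x →L[ℝ] TangentSpace 𝓘(ℝ, E) x) : Prop :=
  ∀ (Y : (x : M) → TangentSpace 𝓘(ℝ, E) x) (x : M),
    MDifferentiableAt 𝓘(ℝ, E) 𝓘(ℝ, E).tangent
      (fun y => (⟨y, Y y⟩ : TangentBundle 𝓘(ℝ, E) M)) x →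
    ∀ v : TangentSpace 𝓘(ℝ, E) x, nabla (fun y => A y (Y y)) x v = A x (nabla Y x v)

/-- The Obata connection: the smooth torsion-free connection on `TM` preserving `I`, `J`, `K`. -/
structure IsObataConnection [FiniteDimensional ℝ E]
    (S : HypercomplexStructure E M)
    (nabla : CovariantDerivative 𝓘(ℝ, E) E (TangentSpace 𝓘(ℝ, E) : M → Type _)) : Prop where
  smooth : nabla.ContMDiffCovariantDerivative ∞
  torsion_free :
    haveI : CompleteSpace E := FiniteDimensional.complete ℝ E
    nabla.torsion = 0
  parallel_I : IsParallelTensor nabla S.I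
  parallel_J : IsParallelTensor nabla S.J
  parallel_K : IsParallelTensor nabla S.K

/-- `0 = τ 0 ≤ τ 1 ≤ ⋯ ≤ τ k = 1`, and `γ` is `C¹` on each `[τ i, τ (i + 1)]`. -/
structure IsPiecewiseC1Path (γ : ℝ → M) (k : ℕ) (τ : ℕ → ℝ) : Prop where
  zero : τ 0 = 0
  one : τ k = 1
  mono : Monotone τ
  contMDiffOn : ∀ i < k, ContMDiffOn 𝓘(ℝ, ℝ) 𝓘(ℝ, E) 1 γ (Icc (τ i) (τ (i + 1)))

/-- A vector field `W` along the curve `γ = proj ∘ W` satisfies `∇_{γ'} W = 0` at time `t`.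
Near `γ t`, write `W s = ∑ fᵢ(s) eᵢ(γ s)` in the frame `eᵢ` of the preferred local trivialization
at `γ t`. Then `(∇_{γ'} W)(t) = ∑ fᵢ'(t) eᵢ(γ t) + ∇_{γ'(t)} (∑ fᵢ(t) eᵢ)`, and
`FiberBundle.extend E (W t)` is the section `∑ fᵢ(t) eᵢ`. -/
def IsParallelAt
    (nabla : CovariantDerivative 𝓘(ℝ, E) E (TangentSpace 𝓘(ℝ, E) : M → Type _))
    (W : ℝ → TangentBundle 𝓘(ℝ, E) M) (t : ℝ) : Prop :=
  HasDerivAt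
    (fun s => (trivializationAt E (TangentSpace 𝓘(ℝ, E)) (W t).proj (W s)).2)
    (-(trivializationAt E (TangentSpace 𝓘(ℝ, E)) (W t).proj
      ⟨(W t).proj, nabla (FiberBundle.extend E (W t).snd) (W t).proj
        (mfderiv 𝓘(ℝ, ℝ) 𝓘(ℝ, E) (fun s => (W s).proj) t (1 : ℝ))⟩).2) t

/-- `W` is a parallel vector field along the piecewise `C¹` path `γ : [0, 1] → M` with break
points `τ i`. -/
structure IsParallelAlong
    (nabla : CovariantDerivative 𝓘(ℝ, E) E (TangentSpace 𝓘(ℝ, E) : M → Type _))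
    (γ : ℝ → M) (k : ℕ) (τ : ℕ → ℝ) (W : ℝ → TangentBundle 𝓘(ℝ, E) M) : Prop where
  proj_eq : ∀ s ∈ Icc (0 : ℝ) 1, (W s).proj = γ s
  continuousOn : ContinuousOn W (Icc 0 1)
  parallel : ∀ i < k, ∀ s ∈ Ioo (τ i) (τ (i + 1)), IsParallelAt nabla W s

/-- `h` is the parallel transport of `∇` around some piecewise `C¹` loop based at `x`. -/
def IsLoopTransport
    (nabla : CovariantDerivative 𝓘(ℝ, E) E (TangentSpace 𝓘(ℝ, E) : M → Type _)) (x : M)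
    (h : TangentSpace 𝓘(ℝ, E) x ≃ₗ[ℝ] TangentSpace 𝓘(ℝ, E) x) : Prop :=
  ∃ (γ : ℝ → M) (k : ℕ) (τ : ℕ → ℝ), IsPiecewiseC1Path (E := E) γ k τ ∧ γ 0 = x ∧ γ 1 = x ∧
    ∀ v : TangentSpace 𝓘(ℝ, E) x, ∃ W : ℝ → TangentBundle 𝓘(ℝ, E) M,
      IsParallelAlong nabla γ k τ W ∧ W 0 = ⟨x, v⟩ ∧ W 1 = ⟨x, h v⟩

/-- The holonomy group `Hol_x(∇)`: the group formed by the parallel transports around loops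
based at `x`. -/
noncomputable def holonomyGroup
    (nabla : CovariantDerivative 𝓘(ℝ, E) E (TangentSpace 𝓘(ℝ, E) : M → Type _)) (x : M) :
    Subgroup (TangentSpace 𝓘(ℝ, E) x ≃ₗ[ℝ] TangentSpace 𝓘(ℝ, E) x) :=
  Subgroup.closure {h | IsLoopTransport nabla x h}

end Geometry

section Quaternionic

variable {V : Type*} [AddCommGroup V] [Module ℝ V]

/-- `GL(n, ℍ)`: the real automorphisms of `V` commuting with the quaternionic operators. -/
def quaternionicGL (I J K : V →ₗ[ℝ] V) : Subgroup (V ≃ₗ[ℝ] V) where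
  carrier := {h | ∀ v, h (I v) = I (h v) ∧ h (J v) = J (h v) ∧ h (K v) = K (h v)}
  one_mem' _ := ⟨rfl, rfl, rfl⟩
  mul_mem' {a b} ha hb v := by
    simp only [LinearEquiv.mul_apply]
    exact ⟨by rw [(hb v).1, (ha _).1], by rw [(hb v).2.1, (ha _).2.1],
      by rw [(hb v).2.2, (ha _).2.2]⟩
  inv_mem' {a} ha v := by
    have key : ∀ w, a (a⁻¹ w) = w := fun w => a.apply_symm_apply w
    refine ⟨a.injective ?_, a.injective ?_, a.injective ?_⟩
    · rw [(ha _).1, key, key]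
    · rw [(ha _).2.1, key, key]
    · rw [(ha _).2.2, key, key]

/-- `V^{1,0}`: the `√-1`-eigenspace of `I` on `ℂ ⊗ V`. -/
noncomputable def holomorphicPart (I : V →ₗ[ℝ] V) : Submodule ℂ (ℂ ⊗[ℝ] V) :=
  Module.End.eigenspace (I.baseChange ℂ) Complex.I

/-- The complex linear action of `GL(n, ℍ)` on `V^{1,0}`. -/
noncomputable def quaternionicGL.onHolomorphicPart (I J K : V →ₗ[ℝ] V) :
    quaternionicGL I J K →* Module.End ℂ (holomorphicPart I) where
  toFun h := ((h : V ≃ₗ[ℝ] V).toLinearMap.baseChange ℂ).restrict (by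
    intro w hw
    rw [holomorphicPart, Module.End.mem_eigenspace_iff] at hw ⊢
    have hc : I ∘ₗ (h : V ≃ₗ[ℝ] V).toLinearMap = (h : V ≃ₗ[ℝ] V).toLinearMap ∘ₗ I :=
      LinearMap.ext fun v => ((h.2 v).1).symm
    rw [← LinearMap.comp_apply, ← LinearMap.baseChange_comp, hc, LinearMap.baseChange_comp,
      LinearMap.comp_apply, hw, map_smul])
  map_one' := by
    ext w
    simp
  map_mul' a b := by
    refine LinearMap.ext fun w => Subtype.ext ?_
    exact LinearMap.congr_fun (LinearMap.baseChange_comp (A := ℂ) (b : V ≃ₗ[ℝ] V).toLinearMap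
      (a : V ≃ₗ[ℝ] V).toLinearMap) (w : ℂ ⊗[ℝ] V)

/-- The determinant on `GL(n, ℍ)`: the scalar by which `h` acts on the top exterior power
`Λ^{2n,0}(V) = Λ^{2n}(V^{1,0})`. -/
noncomputable def quaternionicDet (I J K : V →ₗ[ℝ] V) : quaternionicGL I J K →* ℂ :=
  LinearMap.det.comp (quaternionicGL.onHolomorphicPart I J K)

/-- `SL(n, ℍ)`: the kernel of the determinant in `GL(n, ℍ)`. -/
noncomputable def quaternionicSL (I J K : V →ₗ[ℝ] V) : Subgroup (V ≃ₗ[ℝ] V) :=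
  (quaternionicDet I J K).ker.map (quaternionicGL I J K).subtype

end Quaternionic

/-! The left-invariant vector fields on `G` descend to a global frame of `Γ \ G`, which identifies
every tangent space with the Lie algebra `𝔤`. In this frame the three complex structures have
constant coefficients, and ∇ becomes at each point a bilinear map `A : 𝔤 × 𝔤 → 𝔤`. Parallelism of
the structures says that each `A x` commutes with `I`, `J`, `K`; vanishing torsion says `A x y - A y
x = ⁅x, y⁆`.

The heart of the proof is `tr A x = 0` (`trace_eq_zero_of_torsion_free`). Conjugation by `J` gives
`tr (A x ∘ I) = 0`. Nilpotency gives `tr (ad x) = 0`, so `A x` and `y ↦ A y x` have equal traces.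
The identity `I ⁅I x, y⁆ = A (I x) (I y) + A y x` then gives `tr A x = tr (I ∘ ad (I x))`. This last
trace vanishes because integrability makes `ad x + I ∘ ad (I x)` nilpotent
(`isNilpotent_ad_add_comp_ad`). That `𝔤` is nilpotent is deduced from the group through tangent
spaces of subgroups (`GroupLieAlgebra.isNilpotent`).

In the frame, parallel transport is the linear equation `w' = -A(γ') w`
(`LeftQuotient.hasDerivAt_frameCoord`), whose coefficients are quaternionic and trace free. By
uniqueness its time-one map is quaternionic. On `V^{1,0}` a quaternionic `T` has complex trace `(tr
T - √-1 tr (T ∘ I)) / 2`, which is zero here, so by Liouville's formula the complex determinant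
stays equal to `1` (`mem_quaternionicSL_of_hasDerivAt`). -/

/-! ### Determinants and uniqueness for linear differential equations. -/

/-- Liouville's formula: if `M' = C M`, then `(det M)' = tr(C) det M`. -/
theorem Matrix.hasDerivAt_det {n R : Type*} [Fintype n] [DecidableEq n] [NormedCommRing R]
    [NormedAlgebra ℝ R] {M : ℝ → Matrix n n R} {C : Matrix n n R} {s : ℝ}
    (h : ∀ i j, HasDerivAt (fun t => M t i j) ((C * M s) i j) s) :
    HasDerivAt (fun t => (M t).det) (C.trace * (M s).det) s := by
  have h1 : HasDerivAt (fun t => (M t).det)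
      (∑ i, ((M s).updateRow i ((C * M s) i)).det) s := by
    simp only [Matrix.det_apply']
    rw [Finset.sum_comm]
    refine HasDerivAt.fun_sum fun σ _ => ?_
    rw [← Finset.mul_sum]
    refine HasDerivAt.const_mul _ ?_
    refine (HasDerivAt.fun_finsetProd (u := Finset.univ) (x := s)
      (f := fun i t => M t (σ i) i) fun i _ => h _ _).congr_deriv ?_
    -- The product rule differentiates one column factor at a time, whereas `updateRow` is indexed
    -- by rows; the factor of column `i` sits in row `σ i`.
    rw [← Equiv.sum_comp σ (fun i => ∏ j, ((M s).updateRow i ((C * M s) i)) (σ j) j)]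
    refine Finset.sum_congr rfl fun i _ => ?_
    rw [smul_eq_mul, ← Finset.mul_prod_erase Finset.univ _ (Finset.mem_univ i), mul_comm]
    congr 1
    · simp
    · refine Finset.prod_congr rfl fun j hj => ?_
      rw [Matrix.updateRow_ne]
      simpa using (Finset.mem_erase.mp hj).1
  refine h1.congr_deriv ?_
  rw [Matrix.trace, Finset.sum_mul]
  refine Finset.sum_congr rfl fun i _ => ?_
  -- Replacing row `i` by this combination of the rows multiplies the determinant by the coefficient
  -- of row `i` itself.
  have : (C * M s) i = ∑ k, C i k • M s k := by
    ext j; simp [Matrix.mul_apply]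
  rw [this, Matrix.det_updateRow_sum, smul_eq_mul, Matrix.diag]

/-- A continuous function on `[0, 1]` with vanishing derivative off a countable set is constant. -/
theorem eq_of_hasDerivAt_zero_off_countable {F : Type*} [NormedAddCommGroup F] [NormedSpace ℝ F]
    [CompleteSpace F] {f : ℝ → F} {c : Set ℝ} (hc : c.Countable)
    (hf : ContinuousOn f (Icc 0 1)) (hd : ∀ s ∈ Ioo (0 : ℝ) 1 \ c, HasDerivAt f 0 s)
    {s : ℝ} (hs : s ∈ Icc (0 : ℝ) 1) : f s = f 0 := by
  have := MeasureTheory.integral_eq_of_hasDerivAt_off_countable_of_le f (fun _ => 0) hs.1 hc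
    (hf.mono (Icc_subset_Icc_right hs.2))
    (fun t ht => hd t ⟨⟨ht.1.1, ht.1.2.trans_le hs.2⟩, ht.2⟩) (by simp)
  simpa [sub_eq_zero] using this.symm

section LinearODE

variable {V : Type*} [NormedAddCommGroup V] [NormedSpace ℝ V] [FiniteDimensional ℝ V]
  {W : Type*} [AddCommGroup W]

/-- If `P' = B P` then `det(ρ P)` is constant, where `ρ` is a linear map to an endomorphism algebra
with `ρ(B P) = ρ(B) ρ(P)` and `tr ρ(B) = 0`. -/
theorem det_eq_of_hasDerivAt {𝕜 : Type*} [RCLike 𝕜] [Module 𝕜 W] [Module ℝ W]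
    [IsScalarTower ℝ 𝕜 W] [FiniteDimensional 𝕜 W] (ρ : (V →L[ℝ] V) →ₗ[ℝ] (W →ₗ[𝕜] W))
    {P B : ℝ → V →L[ℝ] V} {c : Set ℝ} (hc : c.Countable) (hP : ContinuousOn P (Icc 0 1))
    (hd : ∀ s ∈ Ioo (0 : ℝ) 1 \ c, HasDerivAt P (B s * P s) s)
    (hρ : ∀ s ∈ Ioo (0 : ℝ) 1 \ c, ρ (B s * P s) = ρ (B s) * ρ (P s))
    (htr : ∀ s ∈ Ioo (0 : ℝ) 1 \ c, LinearMap.trace 𝕜 W (ρ (B s)) = 0)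
    {s : ℝ} (hs : s ∈ Icc (0 : ℝ) 1) : LinearMap.det (ρ (P s)) = LinearMap.det (ρ (P 0)) := by
  classical
  let b := Module.finBasis 𝕜 W
  -- Matrix entries of `ρ T` are real-linear in `T`, hence continuous in finite dimension; this is
  -- how `P' = B P` is differentiated entrywise.
  let L : Fin _ → Fin _ → (V →L[ℝ] V) →L[ℝ] 𝕜 := fun i j => LinearMap.toContinuousLinearMap
    { toFun := fun T => LinearMap.toMatrix b b (ρ T) i j
      map_add' := fun S T => by simp
      map_smul' := fun r T => by
        rw [map_smul, ← algebraMap_smul 𝕜 r (ρ T), map_smul]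
        simp [Algebra.smul_def] }
  have hL : ∀ i j T, L i j T = LinearMap.toMatrix b b (ρ T) i j := fun _ _ _ => rfl
  refine eq_of_hasDerivAt_zero_off_countable (f := fun t => LinearMap.det (ρ (P t))) hc ?_ ?_ hs
  · simp only [← LinearMap.det_toMatrix b, Matrix.det_apply', ← hL]
    fun_prop
  · intro t ht
    simp only [← LinearMap.det_toMatrix b]
    have := Matrix.hasDerivAt_det (M := fun t => LinearMap.toMatrix b b (ρ (P t)))
      (C := LinearMap.toMatrix b b (ρ (B t))) (s := t) fun i j => by
        have := (L i j).hasFDerivAt.comp_hasDerivAt t (hd t ht)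
        rw [← LinearMap.toMatrix_mul, ← hρ t ht]
        exact this
    rwa [← LinearMap.trace_eq_matrix_trace, htr t ht, zero_mul] at this

/-- Solutions of `u' = B u` are determined by an invertible fundamental solution. -/
theorem eq_fundamental_solution_apply {P B : ℝ → V →L[ℝ] V} {c : Set ℝ} (hc : c.Countable)
    (hP : ContinuousOn P (Icc 0 1)) (hd : ∀ s ∈ Ioo (0 : ℝ) 1 \ c, HasDerivAt P (B s * P s) s)
    (h0 : P 0 = 1) (hu : ∀ s ∈ Icc (0 : ℝ) 1, IsUnit (P s)) {u : ℝ → V}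
    (huc : ContinuousOn u (Icc 0 1)) (hud : ∀ s ∈ Ioo (0 : ℝ) 1 \ c, HasDerivAt u (B s (u s)) s)
    {s : ℝ} (hs : s ∈ Icc (0 : ℝ) 1) : u s = P s (u 0) := by
  -- Variation of constants: since `(P⁻¹)' = -P⁻¹ B`, the curve `P⁻¹ u` has zero derivative. No
  -- bound or continuity of `B` is required.
  have key := eq_of_hasDerivAt_zero_off_countable (f := fun t => Ring.inverse (P t) (u t)) hc ?_ ?_ hs
  · rw [h0] at key
    simp only [Ring.inverse_one, one_apply_eq_self] at key
    rw [← key, ← mul_apply_eq_comp, Ring.mul_inverse_cancel _ (hu s hs)]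
    rfl
  · refine ContinuousOn.clm_apply (fun t ht => ?_) huc
    obtain ⟨v, hv⟩ := hu t ht
    have h1 : ContinuousAt Ring.inverse (P t) := by
      rw [← hv]; exact NormedRing.inverse_continuousAt v
    exact ContinuousAt.comp_continuousWithinAt h1 (hP t ht)
  · intro t ht
    obtain ⟨v, hv⟩ := hu t (Ioo_subset_Icc_self ht.1)
    have h1 := hasFDerivAt_ringInverse (𝕜 := ℝ) v
    rw [hv] at h1
    have h2 := (h1.comp_hasDerivAt t (hd t ht)).clm_apply (hud t ht)
    refine h2.congr_deriv ?_
    have hB : B t * P t = B t * v := by rw [hv]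
    rw [← hv, Function.comp_apply, ← hv, Ring.inverse_unit]
    simp [ContinuousLinearMap.mulLeftRight_apply, mul_assoc]

end LinearODE

/-! ### Quaternionic endomorphisms: traces and determinants on `V^{1,0}`. -/

section Quaternionic

variable {V : Type*} [AddCommGroup V] [Module ℝ V]

/-- The projection of `ℂ ⊗ V` onto the `√-1`-eigenspace of `I`. -/
noncomputable def holomorphicProj (I : V →ₗ[ℝ] V) (hI : ∀ v, I (I v) = -v) :
    ℂ ⊗[ℝ] V →ₗ[ℂ] holomorphicPart I :=
  LinearMap.codRestrict _ ((1 / 2 : ℂ) • (1 - Complex.I • I.baseChange ℂ)) (by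
    have hII : ∀ w, I.baseChange ℂ (I.baseChange ℂ w) = -w := fun w => by
      rw [← LinearMap.comp_apply, ← LinearMap.baseChange_comp,
        show I ∘ₗ I = -1 from LinearMap.ext hI, LinearMap.baseChange_neg]
      simp
    intro w
    refine Module.End.mem_eigenspace_iff.mpr ?_
    simp only [LinearMap.smul_apply, LinearMap.sub_apply, Module.End.one_apply, map_smul, map_sub,
      hII]
    rw [smul_comm, smul_sub Complex.I, smul_smul Complex.I Complex.I, Complex.I_mul_I]
    congr 1
    module)

variable {I J : V →ₗ[ℝ] V} {hI : ∀ v, I (I v) = -v}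

lemma holomorphicProj_coe (w : holomorphicPart I) :
    holomorphicProj I hI (w : ℂ ⊗[ℝ] V) = w := by
  have hw := Module.End.mem_eigenspace_iff.mp w.2
  refine Subtype.ext ?_
  show (1 / 2 : ℂ) • ((w : ℂ ⊗[ℝ] V) - Complex.I • I.baseChange ℂ w) = w
  rw [hw, smul_smul, Complex.I_mul_I]
  module

/-- The compression of a real endomorphism to the `√-1`-eigenspace of `I`. -/
noncomputable def holomorphicCompression (I : V →ₗ[ℝ] V) (hI : ∀ v, I (I v) = -v) :
    (V →ₗ[ℝ] V) →ₗ[ℝ] (holomorphicPart I →ₗ[ℂ] holomorphicPart I) where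
  toFun T := holomorphicProj I hI ∘ₗ T.baseChange ℂ ∘ₗ (holomorphicPart I).subtype
  map_add' S T := by ext; simp [LinearMap.baseChange_add]
  map_smul' r T := by
    ext
    simp only [LinearMap.baseChange_smul, LinearMap.comp_apply, LinearMap.smul_apply,
      LinearMap.map_smul_of_tower, RingHom.id_apply]

lemma baseChange_mem_holomorphicPart {T : V →ₗ[ℝ] V} (hT : ∀ v, T (I v) = I (T v))
    {w : ℂ ⊗[ℝ] V} (hw : w ∈ holomorphicPart I) : T.baseChange ℂ w ∈ holomorphicPart I := by
  rw [holomorphicPart, Module.End.mem_eigenspace_iff] at hw ⊢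
  rw [← LinearMap.comp_apply, ← LinearMap.baseChange_comp,
    show I ∘ₗ T = T ∘ₗ I from LinearMap.ext fun v => (hT v).symm, LinearMap.baseChange_comp,
    LinearMap.comp_apply, hw, map_smul]

lemma holomorphicCompression_apply_coe {T : V →ₗ[ℝ] V} (hT : ∀ v, T (I v) = I (T v))
    (w : holomorphicPart I) :
    (holomorphicCompression I hI T w : ℂ ⊗[ℝ] V) = T.baseChange ℂ w :=
  congrArg Subtype.val
    (holomorphicProj_coe (hI := hI) ⟨_, baseChange_mem_holomorphicPart hT w.2⟩)

/-- Only the right factor must commute with `I`: it already maps `V^{1,0}` into itself, so the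
projection inserted between the factors does nothing. -/
lemma holomorphicCompression_mul (S : V →ₗ[ℝ] V) {T : V →ₗ[ℝ] V}
    (hT : ∀ v, T (I v) = I (T v)) :
    holomorphicCompression I hI (S * T) =
      holomorphicCompression I hI S * holomorphicCompression I hI T := by
  refine LinearMap.ext fun w => ?_
  rw [Module.End.mul_apply]
  simp only [holomorphicCompression, LinearMap.coe_mk, AddHom.coe_mk, LinearMap.comp_apply,
    Submodule.subtype_apply]
  congr 1
  rw [Module.End.mul_eq_comp, LinearMap.baseChange_comp, LinearMap.comp_apply,
    ← holomorphicCompression_apply_coe (hI := hI) hT, holomorphicProj_coe]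

/-- Conjugation by `J` fixes `T` and sends `I` to `-I`, so it changes the sign of `T * I` while
preserving its trace. -/
lemma trace_mul_eq_zero_of_anticomm {T : V →ₗ[ℝ] V} (hJ : ∀ v, J (J v) = -v)
    (hIJ : ∀ v, I (J v) = -J (I v)) (hTJ : ∀ v, T (J v) = J (T v)) :
    LinearMap.trace ℝ V (T * I) = 0 := by
  have h1 : T * I = -((T * I * J) * J) := LinearMap.ext fun v => by
    simp only [Module.End.mul_apply, LinearMap.neg_apply, hJ, map_neg, neg_neg]
  have h2 : J * (T * I * J) = T * I := LinearMap.ext fun v => by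
    simp only [Module.End.mul_apply]
    rw [← hTJ, hIJ, map_neg, hJ, neg_neg]
  have h3 := congrArg (LinearMap.trace ℝ V) h1
  rw [map_neg, LinearMap.trace_mul_comm ℝ (T * I * J), h2] at h3
  linarith

/-- Cyclicity of the trace moves the projection `(1 - √-1 I) / 2` to the right of `T`, leaving `(tr
T - √-1 tr (T I)) / 2` computed on all of `ℂ ⊗ V`. -/
lemma trace_holomorphicCompression [FiniteDimensional ℝ V] {T : V →ₗ[ℝ] V}
    (hJ : ∀ v, J (J v) = -v) (hIJ : ∀ v, I (J v) = -J (I v)) (hTJ : ∀ v, T (J v) = J (T v))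
    (htr : LinearMap.trace ℝ V T = 0) :
    LinearMap.trace ℂ _ (holomorphicCompression I hI T) = 0 := by
  have h1 : (T.baseChange ℂ ∘ₗ (holomorphicPart I).subtype) ∘ₗ holomorphicProj I hI =
      (1 / 2 : ℂ) • (T.baseChange ℂ - Complex.I • (T * I).baseChange ℂ) := by
    rw [Module.End.mul_eq_comp, LinearMap.baseChange_comp]
    refine LinearMap.ext fun w => ?_
    simp [holomorphicProj]
  rw [show holomorphicCompression I hI T = holomorphicProj I hI ∘ₗ
    (T.baseChange ℂ ∘ₗ (holomorphicPart I).subtype) from rfl, LinearMap.trace_comp_comm', h1]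
  simp only [map_smul, map_sub, LinearMap.trace_baseChange, htr,
    trace_mul_eq_zero_of_anticomm hJ hIJ hTJ]
  simp

end Quaternionic

/-- If the solutions of `u' = B u` on `[0, 1]`, with `B` quaternionic and trace free off a
countable set, have `h` as their time one map, then `h` lies in `SL(n, ℍ)`. -/
theorem mem_quaternionicSL_of_hasDerivAt {V : Type*} [NormedAddCommGroup V] [NormedSpace ℝ V]
    [FiniteDimensional ℝ V] {I J K : V →ₗ[ℝ] V} (hI : ∀ v, I (I v) = -v)
    (hJ : ∀ v, J (J v) = -v) (hIJ : ∀ v, I (J v) = K v) (hJI : ∀ v, J (I v) = -K v)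
    {h : V ≃ₗ[ℝ] V} {w : V → ℝ → V} {B : ℝ → V →ₗ[ℝ] V} {c : Set ℝ} (hc : c.Countable)
    (hw : ∀ v, ContinuousOn (w v) (Icc 0 1)) (hw0 : ∀ v, w v 0 = v) (hw1 : ∀ v, w v 1 = h v)
    (hd : ∀ v, ∀ s ∈ Ioo (0 : ℝ) 1 \ c, HasDerivAt (w v) (B s (w v s)) s)
    (hBI : ∀ s ∈ Ioo (0 : ℝ) 1 \ c, ∀ v, B s (I v) = I (B s v))
    (hBJ : ∀ s ∈ Ioo (0 : ℝ) 1 \ c, ∀ v, B s (J v) = J (B s v))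
    (htr : ∀ s ∈ Ioo (0 : ℝ) 1 \ c, LinearMap.trace ℝ V (B s) = 0) :
    h ∈ quaternionicSL I J K := by
  let b := Module.finBasis ℝ V
  let C : ℝ → V →L[ℝ] V := fun s => LinearMap.toContinuousLinearMap (B s)
  -- The fundamental solution is assembled from the given solutions that start at the basis vectors.
  let P : ℝ → V →L[ℝ] V := fun s =>
    ∑ i, (LinearMap.toContinuousLinearMap (b.coord i)).smulRight (w (b i) s)
  have hPapply : ∀ s v, P s v = ∑ i, b.repr v i • w (b i) s := fun s v => by
    simp [P]
  have hPc : ContinuousOn P (Icc 0 1) := by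
    refine continuousOn_finsetSum _ fun i _ => ?_
    exact (ContinuousLinearMap.smulRightL ℝ V V
      (LinearMap.toContinuousLinearMap (b.coord i))).continuous.comp_continuousOn (hw (b i))
  have hPd : ∀ s ∈ Ioo (0 : ℝ) 1 \ c, HasDerivAt P (C s * P s) s := fun s hs => by
    refine (HasDerivAt.fun_sum fun i _ => (ContinuousLinearMap.smulRightL ℝ V V
      (LinearMap.toContinuousLinearMap (b.coord i))).hasFDerivAt.comp_hasDerivAt s
        (hd (b i) s hs)).congr_deriv ?_
    ext v
    simp [hPapply, C]
  have hP0 : P 0 = 1 := by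
    ext v
    simp [hPapply, hw0, b.sum_repr]
  have hP1 : ∀ v, P 1 v = h v := fun v => by
    simp only [hPapply, hw1, ← map_smul, ← map_sum, b.sum_repr]
  -- The real determinant comes first: it makes `P` invertible, which the uniqueness argument needs.
  have hdet : ∀ s ∈ Icc (0 : ℝ) 1, LinearMap.det (P s : V →ₗ[ℝ] V) = 1 := fun s hs => by
    have := det_eq_of_hasDerivAt (𝕜 := ℝ) (ContinuousLinearMap.coeLM ℝ) hc hPc hPd
      (fun _ _ => rfl) (fun s hs => htr s hs) hs
    rw [hP0] at this
    exact this.trans LinearMap.det_id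
  have hunit : ∀ s ∈ Icc (0 : ℝ) 1, IsUnit (P s) := fun s hs => by
    have h1 : IsUnit (LinearMap.det (P s : V →ₗ[ℝ] V)) := by rw [hdet s hs]; exact isUnit_one
    let e := LinearEquiv.ofIsUnitDet (f := (P s : V →ₗ[ℝ] V)) (v := b) (v' := b)
      (by rwa [LinearMap.det_toMatrix])
    exact ⟨ContinuousLinearEquiv.toUnit e.toContinuousLinearEquiv, rfl⟩
  -- Both `P s (A v)` and `A (P s v)` solve the equation with initial value `A v`.
  have hcomm : ∀ A : V →ₗ[ℝ] V, (∀ s ∈ Ioo (0 : ℝ) 1 \ c, ∀ v, B s (A v) = A (B s v)) →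
      ∀ s ∈ Icc (0 : ℝ) 1, ∀ v, P s (A v) = A (P s v) := fun A hA s hs v => by
    let L : V →L[ℝ] V := LinearMap.toContinuousLinearMap A
    have := eq_fundamental_solution_apply (u := fun t => L (P t v)) hc hPc hPd hP0 hunit
      (L.continuous.comp_continuousOn (hPc.clm_apply continuousOn_const))
      (fun t ht => by
        refine (L.hasFDerivAt.comp_hasDerivAt t
          ((hPd t ht).clm_apply (hasDerivAt_const t v))).congr_deriv ?_
        simp [L, C, hA t ht]) hs
    simp only [hP0, one_apply_eq_self] at this
    exact this.symm
  have hPI := hcomm I hBI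
  have hPJ := hcomm J hBJ
  have hmem : h ∈ quaternionicGL I J K := fun v => by
    have h1 := hPI 1 (by simp)
    have h2 := hPJ 1 (by simp)
    simp only [hP1] at h1 h2
    exact ⟨h1 v, h2 v, by rw [← hIJ, ← hIJ, h1, h2]⟩
  have hanti : ∀ v, I (J v) = -J (I v) := fun v => by rw [hIJ, hJI, neg_neg]
  -- The compression is defined and linear on all endomorphisms, and is the restriction to `V^{1,0}`
  -- on those commuting with `I`, among them every `P s`.
  let ρ := holomorphicCompression I hI ∘ₗ (ContinuousLinearMap.coeLM ℝ : (V →L[ℝ] V) →ₗ[ℝ] _)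
  have hρ := det_eq_of_hasDerivAt (𝕜 := ℂ) ρ hc hPc hPd
    (fun s hs => holomorphicCompression_mul (hI := hI) (C s : V →ₗ[ℝ] V)
      (T := (P s : V →ₗ[ℝ] V)) (hPI s (Ioo_subset_Icc_self hs.1)))
    (fun s hs => trace_holomorphicCompression (T := B s) hJ hanti (hBJ s hs) (htr s hs))
    (s := 1) (by simp)
  refine ⟨⟨h, hmem⟩, ?_, rfl⟩
  have h1 : quaternionicGL.onHolomorphicPart I J K ⟨h, hmem⟩ = ρ (P 1) := by
    refine LinearMap.ext fun x => Subtype.ext ?_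
    have : (P 1 : V →ₗ[ℝ] V) = h := LinearMap.ext hP1
    refine Eq.trans ?_
      (holomorphicCompression_apply_coe (T := (P 1 : V →ₗ[ℝ] V)) (hPI 1 (by simp)) x).symm
    rw [this]
    rfl
  have h2 : ρ (P 0) = 1 := by
    refine LinearMap.ext fun x => Subtype.ext ?_
    refine (holomorphicCompression_apply_coe (T := (P 0 : V →ₗ[ℝ] V)) (hPI 0 (by simp)) x).trans ?_
    rw [hP0]
    simp
  show LinearMap.det (quaternionicGL.onHolomorphicPart I J K ⟨h, hmem⟩) = 1
  rw [h1, hρ, h2, map_one]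

/-! ### Traces on a nilpotent Lie algebra with an integrable complex structure. -/

section NilpotentComplexStructure

variable {L : Type*} [LieRing L] [LieAlgebra ℝ L]

/-- The real linear map `ℂ ⊗ V → V`, `(a + b √-1) ⊗ v ↦ a v + b I v`. -/
noncomputable def complexContraction {V : Type*} [AddCommGroup V] [Module ℝ V] (I : V →ₗ[ℝ] V) :
    ℂ ⊗[ℝ] V →ₗ[ℝ] V :=
  TensorProduct.lift (Complex.reLm.smulRight LinearMap.id + Complex.imLm.smulRight I)

lemma complexContraction_tmul {V : Type*} [AddCommGroup V] [Module ℝ V] (I : V →ₗ[ℝ] V)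
    (c : ℂ) (v : V) : complexContraction I (c ⊗ₜ v) = c.re • v + c.im • I v := by
  simp [complexContraction]

/-- On a nilpotent Lie algebra with an integrable complex structure `I`, the endomorphisms
`ad x + I ∘ ad (I x)` are nilpotent: they are induced by the adjoint action of `x + √-1 I x` on the
quotient of the complexified Lie algebra by its subalgebra of vectors of type `(0, 1)`. -/
theorem isNilpotent_ad_add_comp_ad [LieRing.IsNilpotent L] {I : L →ₗ[ℝ] L}
    (hI : ∀ x, I (I x) = -x)
    (hint : ∀ x y, ⁅I x, I y⁆ - I ⁅I x, y⁆ - I ⁅x, I y⁆ - ⁅x, y⁆ = 0) (x : L) :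
    IsNilpotent (LieAlgebra.ad ℝ L x + I * LieAlgebra.ad ℝ L (I x)) := by
  set D := LieAlgebra.ad ℝ L x + I * LieAlgebra.ad ℝ L (I x) with hD
  set T := LieAlgebra.ad ℂ (ℂ ⊗[ℝ] L) ((1 : ℂ) ⊗ₜ x + Complex.I ⊗ₜ I x) with hT
  have hTn : IsNilpotent T :=
    LieModule.isNilpotent_toEnd_of_isNilpotent ℂ (ℂ ⊗[ℝ] L) (ℂ ⊗[ℝ] L) _
  have hstep : ∀ w, complexContraction I (T w) = D (complexContraction I w) := fun w => by
    induction w with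
    | zero => simp
    | add a b ha hb => simp only [map_add, ha, hb]
    | tmul c y =>
      -- Integrability enters here: it makes the contraction intertwine `T` and `D` on imaginary
      -- multiples of `y` as well.
      have h1 : I ⁅I x, I y⁆ = I ⁅x, y⁆ - ⁅I x, y⁆ - ⁅x, I y⁆ := by
        have h2 := congrArg I (hint x y)
        simp only [map_sub, hI, map_zero] at h2
        rw [← sub_eq_zero, ← h2]
        abel
      simp only [hT, hD, LieAlgebra.ad_apply, LieAlgebra.ExtendScalars.bracket_tmul,
        map_add, complexContraction_tmul, LinearMap.add_apply, Module.End.mul_apply,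
        map_smul, h1]
      simp
      module
  have hpow : ∀ k w, complexContraction I ((T ^ k) w) = (D ^ k) (complexContraction I w) := by
    intro k
    induction k with
    | zero => simp
    | succ k ih => intro w; rw [pow_succ', pow_succ', Module.End.mul_apply, hstep, ih]; rfl
  obtain ⟨k, hk⟩ := hTn
  refine ⟨k, LinearMap.ext fun y => ?_⟩
  -- The contraction sends `1 ⊗ y` to `y`, so it is onto and `D ^ k` vanishes along with `T ^ k`.
  have := hpow k ((1 : ℂ) ⊗ₜ y)
  rw [hk, complexContraction_tmul] at this
  simpa using this.symm

/-- Let `A` be a torsion-free left-invariant connection on a nilpotent Lie group preserving an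
integrable complex structure `I`, and suppose that `tr (I A_x) = 0`. Then `tr A_x = 0`. -/
theorem trace_eq_zero_of_torsion_free [FiniteDimensional ℝ L] [LieRing.IsNilpotent L]
    {I : L →ₗ[ℝ] L} (hI : ∀ x, I (I x) = -x)
    (hint : ∀ x y, ⁅I x, I y⁆ - I ⁅I x, y⁆ - I ⁅x, I y⁆ - ⁅x, y⁆ = 0)
    (A : L →ₗ[ℝ] L →ₗ[ℝ] L) (hA : ∀ x y, A x y - A y x = ⁅x, y⁆)
    (hAI : ∀ x y, A x (I y) = I (A x y)) (htr : ∀ x, LinearMap.trace ℝ L (A x * I) = 0) (x : L) :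
    LinearMap.trace ℝ L (A x) = 0 := by
  have had : ∀ x, LinearMap.trace ℝ L (LieAlgebra.ad ℝ L x) = 0 := fun x =>
    (LinearMap.isNilpotent_trace_of_isNilpotent
      (LieModule.isNilpotent_toEnd_of_isNilpotent ℝ L L x)).eq_zero
  have hIad : LinearMap.trace ℝ L (I * LieAlgebra.ad ℝ L (I x)) = 0 := by
    have := (LinearMap.isNilpotent_trace_of_isNilpotent
      (isNilpotent_ad_add_comp_ad hI hint x)).eq_zero
    rwa [map_add, had, zero_add] at this
  have h1 : LieAlgebra.ad ℝ L x = A x - A.flip x := LinearMap.ext fun y => by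
    simp [hA]
  -- The term `-I (A y (I x))` becomes `A y x`, as `A y` commutes with `I`. Hence `A.flip x` has
  -- trace zero, and `h1` carries this over to `A x`.
  have h2 : I * LieAlgebra.ad ℝ L (I x) = A (I x) * I + A.flip x := LinearMap.ext fun y => by
    simp [← hA, hAI, hI]
  have h3 := had x
  rw [h1, map_sub] at h3
  rw [h2, map_add, htr] at hIad
  linarith

end NilpotentComplexStructure

/-! ### From a nilpotent Lie group to a nilpotent Lie algebra, in the chart at the identity. -/

section NilpotentLieGroup

open VectorField

variable {E : Type*} [NormedAddCommGroup E] [NormedSpace ℝ E]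
  {G : Type*} [Group G] [TopologicalSpace G] [ChartedSpace E G]

variable (E G) in
/-- The group multiplication in the preferred chart at the identity. -/
noncomputable def chartMul (p : E × E) : E :=
  extChartAt 𝓘(ℝ, E) (1 : G)
    ((extChartAt 𝓘(ℝ, E) (1 : G)).symm p.1 * (extChartAt 𝓘(ℝ, E) (1 : G)).symm p.2)

variable (E G) in
/-- The coordinate of the identity in the preferred chart at the identity. -/
noncomputable def chartOne : E := extChartAt 𝓘(ℝ, E) (1 : G) 1

local notation "φ" => extChartAt 𝓘(ℝ, E) (1 : G)
local notation "𝔪" => chartMul E G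
local notation "𝔬" => chartOne E G

lemma chart_symm_chartOne : (φ).symm 𝔬 = 1 := extChartAt_to_inv (I := 𝓘(ℝ, E)) (1 : G)

lemma contDiffAt_chart_comp {F : Type*} [NormedAddCommGroup F] [NormedSpace ℝ F] {f : F → G} {x : F}
    (hf : ContMDiffAt 𝓘(ℝ, F) 𝓘(ℝ, E) ∞ f x) (hx : f x = 1) :
    ContDiffAt ℝ ∞ (fun y => φ (f y)) x := by
  rw [← contMDiffAt_iff_contDiffAt]
  exact ContMDiffAt.comp x (by rw [hx]; exact contMDiffAt_extChartAt) hf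

lemma eventually_chart_symm_chart {X : Type*} [TopologicalSpace X] {f : X → G} {x : X}
    (hf : ContinuousAt f x) (hx : f x = 1) : ∀ᶠ y in 𝓝 x, (φ).symm (φ (f y)) = f y := by
  have : ∀ᶠ g in 𝓝 (f x), g ∈ (φ).source := by
    rw [hx]; exact extChartAt_source_mem_nhds (I := 𝓘(ℝ, E)) (1 : G)
  filter_upwards [hf.eventually this] with y hy using (φ).left_inv hy

lemma eventually_chartMul_right : ∀ᶠ x in 𝓝 𝔬, 𝔪 (x, 𝔬) = x := by
  filter_upwards [extChartAt_target_mem_nhds (I := 𝓘(ℝ, E)) (1 : G)] with x hx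
  simp only [chartMul, chart_symm_chartOne, mul_one, (φ).right_inv hx]

lemma eventually_chartMul_left : ∀ᶠ x in 𝓝 𝔬, 𝔪 (𝔬, x) = x := by
  filter_upwards [extChartAt_target_mem_nhds (I := 𝓘(ℝ, E)) (1 : G)] with x hx
  simp only [chartMul, chart_symm_chartOne, one_mul, (φ).right_inv hx]

variable [LieGroup 𝓘(ℝ, E) ∞ G]

instance LieGroup.minSmoothness_three : LieGroup 𝓘(ℝ, E) (minSmoothness ℝ 3) G :=
  LieGroup.of_le (n := ∞) (by simpa using ENat.LEInfty.out)

lemma contMDiffAt_chart_symm : ContMDiffAt 𝓘(ℝ, E) 𝓘(ℝ, E) ∞ (φ).symm 𝔬 :=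
  (contMDiffOn_extChartAt_symm (I := 𝓘(ℝ, E)) (n := ∞) (1 : G)).contMDiffAt
    (extChartAt_target_mem_nhds (I := 𝓘(ℝ, E)) (1 : G))

lemma contDiffAt_chartMul : ContDiffAt ℝ ∞ 𝔪 (𝔬, 𝔬) := by
  refine contDiffAt_chart_comp (f := fun p : E × E => (φ).symm p.1 * (φ).symm p.2) ?_
    (by simp only [chart_symm_chartOne, mul_one])
  have h1 : ContMDiffAt 𝓘(ℝ, E × E) 𝓘(ℝ, E) ∞ (fun p : E × E => (φ).symm p.1) (𝔬, 𝔬) :=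
    ContMDiffAt.comp (𝔬, 𝔬) (g := (φ).symm) (f := Prod.fst) contMDiffAt_chart_symm
      contDiffAt_fst.contMDiffAt
  have h2 : ContMDiffAt 𝓘(ℝ, E × E) 𝓘(ℝ, E) ∞ (fun p : E × E => (φ).symm p.2) (𝔬, 𝔬) :=
    ContMDiffAt.comp (𝔬, 𝔬) (g := (φ).symm) (f := Prod.snd) contMDiffAt_chart_symm
      contDiffAt_snd.contMDiffAt
  exact h1.mul h2

lemma eventually_chart_symm_chartMul :
    ∀ᶠ p in 𝓝 (𝔬, 𝔬), (φ).symm (𝔪 p) = (φ).symm p.1 * (φ).symm p.2 := by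
  have : IsTopologicalGroup G := topologicalGroup_of_lieGroup 𝓘(ℝ, E) ∞
  have hc : ContinuousAt (φ).symm 𝔬 := contMDiffAt_chart_symm.continuousAt
  refine eventually_chart_symm_chart (f := fun p : E × E => (φ).symm p.1 * (φ).symm p.2) ?_
    (by simp only [chart_symm_chartOne, mul_one])
  exact (hc.comp_of_eq continuousAt_fst rfl).mul (hc.comp_of_eq continuousAt_snd rfl)

lemma eventually_differentiableAt_chartMul : ∀ᶠ p in 𝓝 (𝔬, 𝔬), DifferentiableAt ℝ 𝔪 p :=
  ((contDiffAt_chartMul (E := E) (G := G)).of_le (m := 1) (by simp)).eventually (by simp) |>.mono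
    fun _ h => h.differentiableAt (by simp)

/-- The two unit laws determine the partial derivatives. -/
lemma fderiv_chartMul (v w : E) : fderiv ℝ 𝔪 (𝔬, 𝔬) (v, w) = v + w := by
  have hd := (eventually_differentiableAt_chartMul (E := E) (G := G)).self_of_nhds.hasFDerivAt
  have h1 : fderiv ℝ 𝔪 (𝔬, 𝔬) (v, 0) = v := by
    have h := hd.comp (f := fun x => (x, 𝔬)) 𝔬 ((hasFDerivAt_id 𝔬).prodMk (hasFDerivAt_const 𝔬 𝔬))
    have := (h.congr_of_eventuallyEq
      ((eventually_chartMul_right (E := E) (G := G)).mono fun x hx => hx.symm)).unique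
        (hasFDerivAt_id 𝔬)
    simpa using DFunLike.congr_fun this v
  have h2 : fderiv ℝ 𝔪 (𝔬, 𝔬) (0, w) = w := by
    have h := hd.comp (f := fun x => (𝔬, x)) 𝔬 ((hasFDerivAt_const 𝔬 𝔬).prodMk (hasFDerivAt_id 𝔬))
    have := (h.congr_of_eventuallyEq
      ((eventually_chartMul_left (E := E) (G := G)).mono fun x hx => hx.symm)).unique
        (hasFDerivAt_id 𝔬)
    simpa using DFunLike.congr_fun this w
  rw [show (v, w) = (v, 0) + (0, w) by simp, map_add, h1, h2]

lemma hasDerivAt_chartMul {c d : ℝ → E} {v w : E} {t : ℝ} (hc : HasDerivAt c v t)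
    (hd : HasDerivAt d w t) (hct : c t = 𝔬) (hdt : d t = 𝔬) :
    HasDerivAt (fun s => 𝔪 (c s, d s)) (v + w) t := by
  have h := (eventually_differentiableAt_chartMul (E := E) (G := G)).self_of_nhds.hasFDerivAt
  have h1 : (c t, d t) = (𝔬, 𝔬) := by rw [hct, hdt]
  rw [← h1] at h
  refine (h.comp_hasDerivAt t (hc.prodMk hd)).congr_deriv ?_
  rw [h1, fderiv_chartMul]

variable (E) in
/-- The tangent space at the identity of a subgroup `H`, consisting of the velocities at the
identity of the curves in `H`. -/
noncomputable def Subgroup.tangent (H : Subgroup G) : Submodule ℝ E where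
  carrier := {v | ∃ c : ℝ → E, c 0 = 𝔬 ∧ HasDerivAt c v 0 ∧ ∀ᶠ t in 𝓝 0, (φ).symm (c t) ∈ H}
  zero_mem' := ⟨fun _ => 𝔬, rfl, hasDerivAt_const _ _, by
    simp only [chart_symm_chartOne, H.one_mem, eventually_true]⟩
  add_mem' := by
    rintro v w ⟨c, hc0, hc, hcH⟩ ⟨d, hd0, hd, hdH⟩
    -- Sums of velocities are realized by pointwise products of curves, which stay in `H`.
    refine ⟨fun t => 𝔪 (c t, d t), ?_, hasDerivAt_chartMul hc hd hc0 hd0, ?_⟩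
    · simp only [hc0, hd0, eventually_chartMul_left.self_of_nhds]
    · have h1 : ContinuousAt (fun t => (c t, d t)) 0 := hc.continuousAt.prodMk hd.continuousAt
      have h2 := eventually_chart_symm_chartMul (E := E) (G := G)
      rw [show (𝔬, 𝔬) = (c 0, d 0) by rw [hc0, hd0]] at h2
      filter_upwards [h1.eventually h2, hcH, hdH] with t ht h3 h4
      rw [ht]
      exact H.mul_mem h3 h4
  smul_mem' := by
    rintro r v ⟨c, hc0, hc, hcH⟩
    have h1 : HasDerivAt (fun t : ℝ => r * t) r 0 := by
      simpa using (hasDerivAt_id (0 : ℝ)).const_mul r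
    rw [← mul_zero r] at hc hcH
    refine ⟨fun t => c (r * t), by simp [hc0], hc.scomp 0 h1, h1.continuousAt.eventually hcH⟩

lemma Subgroup.tangent_top : (⊤ : Subgroup G).tangent E = ⊤ := by
  refine eq_top_iff.mpr fun v _ => ⟨fun t => 𝔬 + t • v, by simp, ?_, by simp⟩
  simpa using ((hasDerivAt_id (0 : ℝ)).smul_const v).const_add 𝔬

lemma Subgroup.tangent_bot : (⊥ : Subgroup G).tangent E = ⊥ := by
  refine eq_bot_iff.mpr ?_
  rintro v ⟨c, hc0, hc, hcH⟩
  have h1 : ∀ᶠ t in 𝓝 0, c t = 𝔬 := by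
    have h2 : ∀ᶠ t in 𝓝 0, c t ∈ (φ).target := by
      refine hc.continuousAt.eventually ?_
      rw [hc0]
      exact extChartAt_target_mem_nhds (I := 𝓘(ℝ, E)) (1 : G)
    filter_upwards [h2, hcH] with t ht h3
    rw [← (φ).right_inv ht, Subgroup.mem_bot.mp h3]
    rfl
  exact (hc.congr_of_eventuallyEq (h1.mono fun t ht => ht.symm)).unique (hasDerivAt_const 0 𝔬)

/-- Differentiating `φ⁻¹ (𝔪 (x, y)) = φ⁻¹ x * φ⁻¹ y` in `y` at the identity: in the chart, a
left-invariant field is a partial derivative of the multiplication. -/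
lemma eventually_mpullbackWithin_mulInvariantVectorField (w : E) :
    mpullbackWithin 𝓘(ℝ, E) 𝓘(ℝ, E) (φ).symm
      (mulInvariantVectorField (I := 𝓘(ℝ, E)) (G := G) w) (range 𝓘(ℝ, E))
      =ᶠ[𝓝 𝔬] fun x => fderiv ℝ 𝔪 (x, 𝔬) (0, w) := by
  have hp : ContinuousAt (fun x : E => (x, 𝔬)) 𝔬 := by fun_prop
  filter_upwards [extChartAt_target_mem_nhds (I := 𝓘(ℝ, E)) (1 : G),
    hp.eventually (eventually_eventually_nhds.mpr (eventually_chart_symm_chartMul (G := G))),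
    hp.eventually (eventually_differentiableAt_chartMul (G := G)),
    eventually_chartMul_right (G := G)] with x hx h1 h2 h3
  have hinv := isInvertible_mfderivWithin_extChartAt_symm (I := 𝓘(ℝ, E)) (x := (1 : G)) hx
  refine hinv.inverse_apply_eq.mpr ?_
  have hs : HasMFDerivAt 𝓘(ℝ, E) 𝓘(ℝ, E) (φ).symm (𝔪 (x, 𝔬))
      (mfderivWithin 𝓘(ℝ, E) 𝓘(ℝ, E) (φ).symm (range 𝓘(ℝ, E)) x : E →L[ℝ] E) := by
    rw [h3]
    have := (mdifferentiableWithinAt_extChartAt_symm (I := 𝓘(ℝ, E)) hx).hasMFDerivWithinAt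
    rw [modelWithCornersSelf_coe, range_id] at this ⊢
    exact this.hasMFDerivAt Filter.univ_mem
  have h0 : HasMFDerivAt 𝓘(ℝ, E) 𝓘(ℝ, E) (φ).symm 𝔬 (ContinuousLinearMap.id ℝ E) := by
    have := (mdifferentiableWithinAt_extChartAt_symm (I := 𝓘(ℝ, E))
      (mem_extChartAt_target (I := 𝓘(ℝ, E)) (1 : G))).hasMFDerivWithinAt
    rw [mfderivWithin_range_extChartAt_symm, modelWithCornersSelf_coe, range_id] at this
    exact this.hasMFDerivAt Filter.univ_mem
  have hL : HasMFDerivAt 𝓘(ℝ, E) 𝓘(ℝ, E) (fun g : G => (φ).symm x * g) ((φ).symm 𝔬)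
      (mfderiv 𝓘(ℝ, E) 𝓘(ℝ, E) (fun g : G => (φ).symm x * g) 1) := by
    rw [chart_symm_chartOne]
    exact ((contMDiff_mul_left (I := 𝓘(ℝ, E)) (n := ∞)).mdifferentiableAt (by simp)).hasMFDerivAt
  have hm : HasMFDerivAt 𝓘(ℝ, E) 𝓘(ℝ, E) (fun y => 𝔪 (x, y)) 𝔬
      ((fderiv ℝ 𝔪 (x, 𝔬)).comp (ContinuousLinearMap.inr ℝ E E)) :=
    (h2.hasFDerivAt.comp 𝔬 (hasFDerivAt_prodMk_right x 𝔬)).hasMFDerivAt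
  have e1 := hL.comp 𝔬 h0
  have e2 := hs.comp 𝔬 hm
  have hy : ContinuousAt (fun y : E => (x, y)) 𝔬 := by fun_prop
  have e3 := e2.congr_of_eventuallyEq ((hy.eventually h1).mono fun y hy => hy.symm)
  exact DFunLike.congr_fun (hasMFDerivAt_unique e1 e3) w

variable (E G) in
/-- The Lie bracket on the tangent space at the identity, seen in the model space. -/
noncomputable def modelBracket (u w : E) : E :=
  @Bracket.bracket (GroupLieAlgebra 𝓘(ℝ, E) G) (GroupLieAlgebra 𝓘(ℝ, E) G) _ u w

theorem modelBracket_eq_fderiv_chartMul (u w : E) :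
    modelBracket E G u w = fderiv ℝ (fun x => fderiv ℝ 𝔪 (x, 𝔬) (0, w)) 𝔬 u -
        fderiv ℝ (fun x => fderiv ℝ 𝔪 (x, 𝔬) (0, u)) 𝔬 w := by
  let V : E → E → E := fun v => mpullbackWithin 𝓘(ℝ, E) 𝓘(ℝ, E) (φ).symm
    (mulInvariantVectorField (I := 𝓘(ℝ, E)) (G := G) v) (range 𝓘(ℝ, E))
  -- The tangent space at `1` is identified with `E` by this very chart, whose derivative there is
  -- therefore the identity.
  let A : E →L[ℝ] E := mfderiv 𝓘(ℝ, E) 𝓘(ℝ, E) φ (1 : G)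
  have hA : A = ContinuousLinearMap.id ℝ E := mfderiv_extChartAt_self
  show A.inverse (lieBracketWithin ℝ (V u) (V w) ((φ).symm ⁻¹' univ ∩ range 𝓘(ℝ, E)) 𝔬) = _
  rw [hA, ContinuousLinearMap.inverse_id, ContinuousLinearMap.id_apply]
  have h := fun v => fderiv_chartMul (G := G) 0 (v : E)
  simp only [zero_add] at h
  have key : ∀ {V W V' W' : E → E} {s : Set E}, s = univ → V =ᶠ[𝓝 𝔬] V' → W =ᶠ[𝓝 𝔬] W' →
      lieBracketWithin ℝ V W s 𝔬 = fderiv ℝ W' 𝔬 (V' 𝔬) - fderiv ℝ V' 𝔬 (W' 𝔬) := by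
    intro V W V' W' s hs hV hW
    rw [hs, lieBracketWithin_univ, hV.lieBracket_vectorField_eq hW]
    rfl
  refine (key (by rw [show range 𝓘(ℝ, E) = univ from range_id]; simp)
    (eventually_mpullbackWithin_mulInvariantVectorField u)
    (eventually_mpullbackWithin_mulInvariantVectorField w)).trans ?_
  rw [h, h]

/-- For `g = φ⁻¹ x` and a curve `c` in `H`, the commutators `k = g c g⁻¹ c⁻¹` satisfy `k c g = g c`.
Differentiating at time zero gives the identity, with `v` the velocity of `k`; intrinsically `v =
Ad_g w - w`. -/
lemma Subgroup.eventually_exists_mem_tangent_commutator {H : Subgroup G} {w : E}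
    (hw : w ∈ H.tangent E) : ∀ᶠ x in 𝓝 𝔬, ∃ v ∈ (⁅(⊤ : Subgroup G), H⁆).tangent E,
      fderiv ℝ 𝔪 (𝔬, x) (v + w, 0) = fderiv ℝ 𝔪 (x, 𝔬) (0, w) := by
  have : IsTopologicalGroup G := topologicalGroup_of_lieGroup 𝓘(ℝ, E) ∞
  obtain ⟨c, hc0, hc, hcH⟩ := hw
  have hp : ContinuousAt (fun x : E => (x, 𝔬)) 𝔬 := by fun_prop
  have hq : ContinuousAt (fun x : E => (𝔬, x)) 𝔬 := by fun_prop
  filter_upwards [hp.eventually (eventually_differentiableAt_chartMul (G := G)),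
    hq.eventually (eventually_differentiableAt_chartMul (G := G))] with x h1 h2
  set g := (φ).symm x with hg
  have hcs : ContMDiffAt 𝓘(ℝ, E) 𝓘(ℝ, E) ∞ (φ).symm (c 0) := by
    rw [hc0]; exact contMDiffAt_chart_symm
  have hf1 : g * (φ).symm (c 0) * g⁻¹ * ((φ).symm (c 0))⁻¹ = 1 := by
    rw [hc0, chart_symm_chartOne]; group
  have hf : DifferentiableAt ℝ
      (fun y => φ (g * (φ).symm y * g⁻¹ * ((φ).symm y)⁻¹)) (c 0) :=
    (contDiffAt_chart_comp (((contMDiffAt_const.mul hcs).mul contMDiffAt_const).mul hcs.inv)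
      hf1).differentiableAt (by simp)
  have hk := hf.hasFDerivAt.comp_hasDerivAt 0 hc
  set v := fderiv ℝ (fun y => φ (g * (φ).symm y * g⁻¹ * ((φ).symm y)⁻¹)) (c 0) w
  set k : ℝ → E := (fun y => φ (g * (φ).symm y * g⁻¹ * ((φ).symm y)⁻¹)) ∘ c with hkdef
  have hk0 : k 0 = 𝔬 := by simp only [hkdef, Function.comp_apply, hf1]; rfl
  have hks : ∀ᶠ t in 𝓝 0, (φ).symm (k t) = g * (φ).symm (c t) * g⁻¹ * ((φ).symm (c t))⁻¹ := by
    refine eventually_chart_symm_chart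
      (f := fun t => g * (φ).symm (c t) * g⁻¹ * ((φ).symm (c t))⁻¹) ?_ hf1
    have := ContinuousAt.comp (g := (φ).symm) hcs.continuousAt hc.continuousAt
    exact ((continuousAt_const.mul this).mul continuousAt_const).mul this.inv
  refine ⟨v, ⟨k, hk0, hk, ?_⟩, ?_⟩
  · filter_upwards [hks, hcH] with t ht htH
    rw [ht]
    exact Subgroup.commutator_mem_commutator (Subgroup.mem_top g) htH
  · have hmul := hasDerivAt_chartMul hk hc hk0 hc0
    have h3 : 𝔪 (k 0, c 0) = 𝔬 := by rw [hk0, hc0, eventually_chartMul_left.self_of_nhds]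
    rw [← h3] at h2
    have e1 := h2.hasFDerivAt.comp_hasDerivAt 0 (hmul.prodMk (hasDerivAt_const 0 x))
    rw [← hc0] at h1
    have e2 := h1.hasFDerivAt.comp_hasDerivAt 0 ((hasDerivAt_const 0 x).prodMk hc)
    rw [h3] at e1
    rw [hc0] at e2
    refine e1.unique (e2.congr_of_eventuallyEq ?_)
    have h4 : ContinuousAt (fun t => (k t, c t)) 0 := hk.continuousAt.prodMk hc.continuousAt
    have h5 := eventually_chart_symm_chartMul (E := E) (G := G)
    rw [show (𝔬, 𝔬) = (k 0, c 0) by rw [hk0, hc0]] at h5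
    filter_upwards [hks, h4.eventually h5] with t ht1 ht2
    simp only [Function.comp_apply]
    rw [chartMul, ht2, ht1, chartMul]
    congr 1
    show _ * g = g * (φ).symm (c t)
    group

theorem Submodule.mem_of_hasDerivAt {F : Type*} [NormedAddCommGroup F] [NormedSpace ℝ F]
    [FiniteDimensional ℝ F] {T : Submodule ℝ F} {f : ℝ → F} {v : F} {t : ℝ} (hf : HasDerivAt f v t)
    (hT : ∀ᶠ s in 𝓝 t, f s ∈ T) : v ∈ T := by
  refine T.closed_of_finiteDimensional.mem_of_tendsto (hasDerivAt_iff_tendsto_slope.mp hf) ?_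
  filter_upwards [hT.filter_mono nhdsWithin_le_nhds] with s hs
  exact T.smul_mem _ (T.sub_mem hs hT.self_of_nhds)

/-- The vectors `Ad_g w - w` lie in the tangent space of the commutator subgroup. Differentiating
them in `g` at the identity in the direction `u` gives `⁅u, w⁆`, and a finite-dimensional subspace,
being closed, contains the derivatives of its curves. -/
theorem Subgroup.modelBracket_mem_tangent_commutator [FiniteDimensional ℝ E]
    {H : Subgroup G} (u : E) {w : E} (hw : w ∈ H.tangent E) :
    modelBracket E G u w ∈ (⁅(⊤ : Subgroup G), H⁆).tangent E := by
  have hC2 : ContDiffAt ℝ 2 𝔪 (𝔬, 𝔬) := contDiffAt_chartMul.of_le ENat.LEInfty.out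
  have hd : HasFDerivAt (fderiv ℝ 𝔪) (fderiv ℝ (fderiv ℝ 𝔪) (𝔬, 𝔬)) (𝔬, 𝔬) :=
    ((hC2.fderiv_right (m := 1) le_rfl).differentiableAt (by simp)).hasFDerivAt
  set D := fderiv ℝ (fderiv ℝ 𝔪) (𝔬, 𝔬)
  have hsymm : ∀ p q : E × E, D p q = D q p := hC2.isSymmSndFDerivAt (by simp)
  have hL : ∀ v : E, HasFDerivAt (fun x => fderiv ℝ 𝔪 (x, 𝔬) (0, v))
      ((ContinuousLinearMap.apply ℝ E ((0 : E), v)).comp (D.comp (ContinuousLinearMap.inl ℝ E E)))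
      𝔬 := fun v =>
    (ContinuousLinearMap.apply ℝ E ((0 : E), v)).hasFDerivAt.comp 𝔬
      (hd.comp (f := fun x => (x, 𝔬)) 𝔬 (hasFDerivAt_prodMk_left 𝔬 𝔬))
  have hbr : modelBracket E G u w = D (u, 0) (0, w) - D (w, 0) (0, u) := by
    rw [modelBracket_eq_fderiv_chartMul, (hL w).fderiv, (hL u).fderiv]
    rfl
  let R : (E × E →L[ℝ] E) →L[ℝ] (E →L[ℝ] E) :=
    (ContinuousLinearMap.compL ℝ E (E × E) E).flip (ContinuousLinearMap.inl ℝ E E)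
  -- `B x` is the derivative at the identity of right translation by `x`, so `(B x)⁻¹` applied to
  -- the left-invariant field of `w` is `Ad_x w`.
  let B : E → E →L[ℝ] E := fun x => R (fderiv ℝ 𝔪 (𝔬, x))
  have hB : HasFDerivAt B (R.comp (D.comp (ContinuousLinearMap.inr ℝ E E))) 𝔬 :=
    R.hasFDerivAt.comp 𝔬 (hd.comp 𝔬 (hasFDerivAt_prodMk_right 𝔬 𝔬))
  have hB0 : B 𝔬 = ((1 : (E →L[ℝ] E)ˣ) : E →L[ℝ] E) := by
    ext v
    have := fderiv_chartMul (G := G) v 0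
    rw [add_zero] at this
    exact this
  have hinv := hasFDerivAt_ringInverse (𝕜 := ℝ) (1 : (E →L[ℝ] E)ˣ)
  rw [← hB0] at hinv
  have hα := (hinv.comp 𝔬 hB).clm_apply (hL w)
  have hline : HasDerivAt (fun s : ℝ => 𝔬 + s • u) u 0 := by
    simpa using ((hasDerivAt_id (0 : ℝ)).smul_const u).const_add 𝔬
  have h0 : 𝔬 = 𝔬 + (0 : ℝ) • u := by simp
  rw [h0] at hα
  have hfin := (hα.comp_hasDerivAt 0 hline).sub_const w
  rw [← h0] at hfin
  refine Submodule.mem_of_hasDerivAt (hfin.congr_deriv (g' := modelBracket E G u w) ?_) ?_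
  · have h1 := fderiv_chartMul (G := G) 0 w
    rw [zero_add] at h1
    -- The derivative of `B⁻¹` contributes `-D (0, u) (w, 0)`; symmetry of the second derivative
    -- matches it with the second term of the bracket.
    rw [hbr, hsymm (w, 0)]
    simp [hB0, h1, R, ContinuousLinearMap.mulLeftRight_apply]
    abel
  · have hunit : ∀ᶠ x in 𝓝 𝔬, IsUnit (B x) :=
      hB.continuousAt.eventually (Units.isOpen.mem_nhds ⟨1, hB0.symm⟩)
    have hlc := hline.continuousAt
    rw [ContinuousAt, ← h0] at hlc
    filter_upwards [hlc.eventually hunit,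
      hlc.eventually (Subgroup.eventually_exists_mem_tangent_commutator hw)] with s hs1 hs2
    obtain ⟨v, hv, hvw⟩ := hs2
    have h2 : B (𝔬 + s • u) (v + w) = fderiv ℝ 𝔪 (𝔬 + s • u, 𝔬) (0, w) := hvw
    have h3 : Ring.inverse (B (𝔬 + s • u)) (fderiv ℝ 𝔪 (𝔬 + s • u, 𝔬) (0, w)) = v + w := by
      rw [← h2, ← mul_apply_eq_comp, Ring.inverse_mul_cancel _ hs1]
      rfl
    simpa [h3] using hv

/-- The Lie algebra of a nilpotent Lie group is nilpotent. -/
theorem GroupLieAlgebra.isNilpotent [FiniteDimensional ℝ E] [CompleteSpace E] [Group.IsNilpotent G] :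
    LieRing.IsNilpotent (GroupLieAlgebra 𝓘(ℝ, E) G) := by
  let T : ℕ → Submodule ℝ (GroupLieAlgebra 𝓘(ℝ, E) G) := fun k =>
    (((⊤ : Subgroup G).lowerCentralSeries k).tangent E : Submodule ℝ E)
  have hT0 : T 0 = ⊤ := Subgroup.tangent_top
  have hTs : ∀ k (u w : GroupLieAlgebra 𝓘(ℝ, E) G), w ∈ T k →
      ⁅u, w⁆ ∈ T (k + 1) := fun k (u w : GroupLieAlgebra 𝓘(ℝ, E) G) hw => by
    have := Subgroup.modelBracket_mem_tangent_commutator (E := E) u (w := w) hw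
    rw [Subgroup.commutator_comm] at this
    exact this
  have key : ∀ k, (LieModule.lowerCentralSeries ℝ (GroupLieAlgebra 𝓘(ℝ, E) G)
      (GroupLieAlgebra 𝓘(ℝ, E) G) k).toSubmodule ≤ T k := by
    intro k
    induction k with
    | zero => rw [hT0]; exact le_top
    | succ k ih =>
      rw [LieModule.lowerCentralSeries_succ, LieSubmodule.lieIdeal_oper_eq_linear_span']
      refine Submodule.span_le.mpr ?_
      rintro _ ⟨u, -, w, hw, rfl⟩
      exact hTs k u w (ih hw)
  obtain ⟨k, hk⟩ := Subgroup.nilpotent_iff_lowerCentralSeries.mp ‹Group.IsNilpotent G›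
  have hTk : T k = ⊥ := by
    simp only [T, hk]
    exact Subgroup.tangent_bot
  refine (LieModule.isNilpotent_iff ℝ _ _).mpr ⟨k, ?_⟩
  rw [← LieSubmodule.toSubmodule_eq_bot, eq_bot_iff, ← hTk]
  exact key k

end NilpotentLieGroup

/-! ### The left-invariant frame of the quotient. -/

section Frame

open Bundle VectorField

variable {E : Type*} [NormedAddCommGroup E] [NormedSpace ℝ E]
  {G : Type*} [Group G] [TopologicalSpace G] [ChartedSpace E G] [LieGroup 𝓘(ℝ, E) ∞ G]

lemma isLocalDiffeomorph_mul_left (g : G) :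
    IsLocalDiffeomorph 𝓘(ℝ, E) 𝓘(ℝ, E) ∞ (fun h : G => g * h) := by
  let Φ : G ≃ₘ^∞⟮𝓘(ℝ, E), 𝓘(ℝ, E)⟯ G :=
    { Equiv.mulLeft g with
      contMDiff_toFun := contMDiff_mul_left
      contMDiff_invFun := contMDiff_mul_left }
  exact Φ.isLocalDiffeomorph

/-- The value at `g` is the tangent map of multiplication at the zero vector over `g` paired with
`v` over `1`, a composite of smooth maps. -/
theorem isSmoothVectorField_mulInvariantVectorField (v : GroupLieAlgebra 𝓘(ℝ, E) G) :
    IsSmoothVectorField (mulInvariantVectorField (I := 𝓘(ℝ, E)) (G := G) v) := by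
  rw [IsSmoothVectorField]
  let fg : G → TangentBundle 𝓘(ℝ, E) G := fun g ↦ TotalSpace.mk' E g 0
  have sfg : CMDiff ∞ fg := contMDiff_zeroSection _ _
  let fv : G → TangentBundle 𝓘(ℝ, E) G := fun _ ↦ TotalSpace.mk' E 1 v
  have sfv : CMDiff ∞ fv := contMDiff_const
  let F₁ : G → (TangentBundle 𝓘(ℝ, E) G × TangentBundle 𝓘(ℝ, E) G) := fun g ↦ (fg g, fv g)
  have S₁ : CMDiff ∞ F₁ := sfg.prodMk sfv
  let F₂ : (TangentBundle 𝓘(ℝ, E) G × TangentBundle 𝓘(ℝ, E) G) →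
      TangentBundle (𝓘(ℝ, E).prod 𝓘(ℝ, E)) (G × G) :=
    (equivTangentBundleProd 𝓘(ℝ, E) G 𝓘(ℝ, E) G).symm
  have S₂ : CMDiff ∞ F₂ := contMDiff_equivTangentBundleProd_symm
  let F₃ : TangentBundle (𝓘(ℝ, E).prod 𝓘(ℝ, E)) (G × G) → TangentBundle 𝓘(ℝ, E) G :=
    tangentMap% (fun (p : G × G) ↦ p.1 * p.2)
  have S₃ : CMDiff ∞ F₃ :=
    ContMDiff.contMDiff_tangentMap (n := ∞) (contMDiff_mul 𝓘(ℝ, E) ∞) (m := ∞) (by simp)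
  let S := (S₃.comp S₂).comp S₁
  convert! S with g
  · simp [F₁, F₂, F₃, fg, fv]
  · simp only [Function.comp_apply, tangentMap, F₃, F₂, F₁, fg, fv]
    rw [mfderiv_prod_eq_add_apply ((contMDiff_mul 𝓘(ℝ, E) ∞).mdifferentiableAt (by simp))]
    let L : E →L[ℝ] E := mfderiv 𝓘(ℝ, E) 𝓘(ℝ, E) (fun z : G => z * 1) g
    let R : E →L[ℝ] E := mfderiv 𝓘(ℝ, E) 𝓘(ℝ, E) (fun z : G => g * z) 1
    change R v = L 0 + R v
    rw [map_zero, zero_add]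

variable (Γ : Subgroup G) [DiscreteTopology Γ]

lemma LeftQuotient.isLocalDiffeomorphAt_mk_mul (g : G) :
    IsLocalDiffeomorphAt 𝓘(ℝ, E) 𝓘(ℝ, E) ∞ (fun h => LeftQuotient.mk Γ (g * h)) 1 :=
  (isLocalDiffeomorph_mul_left g 1).comp 𝓘(ℝ, E) _
    (LeftQuotient.isLocalDiffeomorph_mk Γ (g * 1))

/-- The left invariant framing of `Γ \ G` by the Lie algebra of `G`. -/
noncomputable def LeftQuotient.frame (p : LeftQuotient Γ) :
    GroupLieAlgebra 𝓘(ℝ, E) G ≃L[ℝ] TangentSpace 𝓘(ℝ, E) p :=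
  (LeftQuotient.isLocalDiffeomorphAt_mk_mul Γ
    (LeftQuotient.mk_surjective Γ p).choose).mfderivToContinuousLinearEquiv (by simp)

/-- The frame is defined through a chosen representative. Any other differs from it by a left factor
in `Γ`, which the projection absorbs. -/
lemma LeftQuotient.frame_mk (g : G) (v : GroupLieAlgebra 𝓘(ℝ, E) G) :
    LeftQuotient.frame Γ (LeftQuotient.mk Γ g) v =
      mfderiv 𝓘(ℝ, E) 𝓘(ℝ, E) (LeftQuotient.mk Γ) g
        (mulInvariantVectorField (I := 𝓘(ℝ, E)) (G := G) v g) := by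
  obtain ⟨γ, hγ, h⟩ := LeftQuotient.mk_eq_mk_iff.mp
    (LeftQuotient.mk_surjective Γ (LeftQuotient.mk Γ g)).choose_spec
  have h1 : (fun h => LeftQuotient.mk Γ
      ((LeftQuotient.mk_surjective Γ (LeftQuotient.mk Γ g)).choose * h)) =
      fun h => LeftQuotient.mk Γ (g * h) := by
    funext x
    rw [LeftQuotient.mk_eq_mk_iff]
    exact ⟨γ, hγ, by rw [← mul_assoc, h]⟩
  have h2 : mfderiv 𝓘(ℝ, E) 𝓘(ℝ, E) (fun h => LeftQuotient.mk Γ (g * h)) 1 =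
      (mfderiv 𝓘(ℝ, E) 𝓘(ℝ, E) (LeftQuotient.mk Γ) (g * 1)).comp
        (mfderiv 𝓘(ℝ, E) 𝓘(ℝ, E) (fun h => g * h) 1) :=
    mfderiv_comp (1 : G) ((LeftQuotient.isLocalDiffeomorph_mk Γ).mdifferentiable (by simp) _)
      ((isLocalDiffeomorph_mul_left g).mdifferentiable (by simp) _)
  have h3 : LeftQuotient.frame Γ (LeftQuotient.mk Γ g) v =
      mfderiv 𝓘(ℝ, E) 𝓘(ℝ, E) (fun h => LeftQuotient.mk Γ
      ((LeftQuotient.mk_surjective Γ (LeftQuotient.mk Γ g)).choose * h)) 1 v := rfl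
  -- The two derivatives land in tangent spaces at points not definitionally equal, so they are
  -- compared in `E`.
  have key : ∀ (f f' : G → LeftQuotient Γ), f = f' → ∀ v : E,
      (mfderiv 𝓘(ℝ, E) 𝓘(ℝ, E) f 1 : E →L[ℝ] E) v = (mfderiv 𝓘(ℝ, E) 𝓘(ℝ, E) f' 1 : E →L[ℝ] E) v := by
    rintro f f' rfl v; rfl
  refine h3.trans ((key _ _ h1 v).trans ((DFunLike.congr_fun h2 v).trans ?_))
  have key2 : ∀ (a b : G), a = b → ∀ v : E,
      (mfderiv 𝓘(ℝ, E) 𝓘(ℝ, E) (LeftQuotient.mk Γ) a : E →L[ℝ] E) v =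
      (mfderiv 𝓘(ℝ, E) 𝓘(ℝ, E) (LeftQuotient.mk Γ) b : E →L[ℝ] E) v := by
    rintro a b rfl v; rfl
  exact key2 _ _ (mul_one g) _

/-- The derivative of the projection `G → Γ \ G`. -/
noncomputable def LeftQuotient.mfderivMk (g : G) :
    TangentSpace 𝓘(ℝ, E) g ≃L[ℝ] TangentSpace 𝓘(ℝ, E) (LeftQuotient.mk Γ g) :=
  (LeftQuotient.isLocalDiffeomorph_mk Γ g).mfderivToContinuousLinearEquiv (by simp)

lemma LeftQuotient.coe_mfderivMk (g : G) :
    (LeftQuotient.mfderivMk (E := E) Γ g : TangentSpace 𝓘(ℝ, E) g →L[ℝ] _) =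
      mfderiv 𝓘(ℝ, E) 𝓘(ℝ, E) (LeftQuotient.mk Γ) g :=
  (LeftQuotient.isLocalDiffeomorph_mk Γ g).mfderivToContinuousLinearEquiv_coe (by simp)

lemma LeftQuotient.mpullback_frame (v : GroupLieAlgebra 𝓘(ℝ, E) G) :
    mpullback 𝓘(ℝ, E) 𝓘(ℝ, E) (LeftQuotient.mk Γ) (fun p => LeftQuotient.frame Γ p v) =
      mulInvariantVectorField v := by
  funext g
  rw [mpullback_apply, LeftQuotient.frame_mk, ← LeftQuotient.coe_mfderivMk,
    ContinuousLinearMap.inverse_equiv]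
  exact (LeftQuotient.mfderivMk (E := E) Γ g).symm_apply_apply _

lemma LeftQuotient.contMDiff_frame (v : GroupLieAlgebra 𝓘(ℝ, E) G) :
    IsSmoothVectorField (fun p => LeftQuotient.frame Γ p v) := by
  intro p
  obtain ⟨g, rfl⟩ := LeftQuotient.mk_surjective Γ p
  have hl := LeftQuotient.isLocalDiffeomorph_mk (E := E) Γ g
  have h1 : ContMDiffAt 𝓘(ℝ, E) 𝓘(ℝ, E).tangent ∞
      (fun q => (⟨hl.localInverse q, mulInvariantVectorField v (hl.localInverse q)⟩ :
        TangentBundle 𝓘(ℝ, E) G)) (LeftQuotient.mk Γ g) :=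
    ContMDiffAt.comp (LeftQuotient.mk Γ g)
      (isSmoothVectorField_mulInvariantVectorField v _) hl.localInverse_contMDiffAt
  have h2 : ContMDiff 𝓘(ℝ, E).tangent 𝓘(ℝ, E).tangent ∞
      (tangentMap 𝓘(ℝ, E) 𝓘(ℝ, E) (LeftQuotient.mk Γ)) :=
    (LeftQuotient.isLocalDiffeomorph_mk Γ).contMDiff.contMDiff_tangentMap (m := ∞) (by simp)
  refine (ContMDiffAt.comp (LeftQuotient.mk Γ g) (h2 _) h1).congr_of_eventuallyEq ?_
  filter_upwards [hl.localInverse_eventuallyEq_right] with q hq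
  have hq' : LeftQuotient.mk Γ (hl.localInverse q) = q := hq
  conv_lhs => rw [← hq']
  simp only [Function.comp_apply, tangentMap, LeftQuotient.frame_mk]

variable [CompleteSpace E]

/-- The frame fields pull back to left-invariant fields under a local diffeomorphism, and brackets
are natural under pullback. -/
lemma LeftQuotient.mlieBracket_frame (u v : GroupLieAlgebra 𝓘(ℝ, E) G) (p : LeftQuotient Γ) :
    mlieBracket 𝓘(ℝ, E) (fun p => LeftQuotient.frame Γ p u)
      (fun p => LeftQuotient.frame Γ p v) p =
      LeftQuotient.frame Γ p
        (@Bracket.bracket (GroupLieAlgebra 𝓘(ℝ, E) G) (GroupLieAlgebra 𝓘(ℝ, E) G) _ u v) := by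
  have h0 : minSmoothness ℝ 2 ≤ ∞ := by simpa using ENat.LEInfty.out
  have hG : IsManifold 𝓘(ℝ, E) (minSmoothness ℝ 2) G := IsManifold.of_le h0
  have hN : IsManifold 𝓘(ℝ, E) (minSmoothness ℝ 2) (LeftQuotient Γ) := IsManifold.of_le h0
  obtain ⟨g, rfl⟩ := LeftQuotient.mk_surjective Γ p
  have h := mpullback_mlieBracket (n := ∞) (x₀ := g) (f := LeftQuotient.mk Γ)
    ((LeftQuotient.contMDiff_frame Γ u).mdifferentiable (by simp) _)
    ((LeftQuotient.contMDiff_frame Γ v).mdifferentiable (by simp) _)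
    ((LeftQuotient.isLocalDiffeomorph_mk Γ).contMDiff _) h0
  rw [LeftQuotient.mpullback_frame, LeftQuotient.mpullback_frame,
    ← mulInvariantVector_mlieBracket, mpullback_apply, ← LeftQuotient.coe_mfderivMk,
    ContinuousLinearMap.inverse_equiv] at h
  rw [LeftQuotient.frame_mk, GroupLieAlgebra.bracket_def, ← h, ← LeftQuotient.coe_mfderivMk]
  exact ((LeftQuotient.mfderivMk (E := E) Γ g).apply_symm_apply _).symm

end Frame

/-! ### The connection form of the Obata connection. -/

section ConnectionForm

open Bundle VectorField

variable {E : Type*} [NormedAddCommGroup E] [NormedSpace ℝ E]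
  {G : Type*} [Group G] [TopologicalSpace G] [ChartedSpace E G]

lemma apply_mulInvariantVectorField
    {A : (x : G) → TangentSpace 𝓘(ℝ, E) x →L[ℝ] TangentSpace 𝓘(ℝ, E) x}
    (hA : ∀ g : G, IsHolomorphicMap (fun x => g * x) A A) (g : G)
    (v : GroupLieAlgebra 𝓘(ℝ, E) G) :
    A g (mulInvariantVectorField v g) = mulInvariantVectorField (A 1 v) g := by
  have key : ∀ (a b : G), a = b → ∀ v : E, (A a : E →L[ℝ] E) v = (A b : E →L[ℝ] E) v := by
    rintro a b rfl v; rfl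
  exact (key _ _ (mul_one g).symm _).trans ((hA g).2 1 v).symm

variable [LieGroup 𝓘(ℝ, E) ∞ G]

/-- The Nijenhuis tensor is evaluated at `1` on left-invariant fields, which `A` maps to
left-invariant fields. -/
lemma isComplexStructure_lie [CompleteSpace E]
    {A : (x : G) → TangentSpace 𝓘(ℝ, E) x →L[ℝ] TangentSpace 𝓘(ℝ, E) x}
    (hA : IsComplexStructure A) (hinv : ∀ g : G, IsHolomorphicMap (fun x => g * x) A A)
    (u v : GroupLieAlgebra 𝓘(ℝ, E) G) :
    let I : GroupLieAlgebra 𝓘(ℝ, E) G →ₗ[ℝ] GroupLieAlgebra 𝓘(ℝ, E) G := (A 1).toLinearMap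
    ⁅I u, I v⁆ - I ⁅I u, v⁆ - I ⁅u, I v⁆ - ⁅u, v⁆ = 0 := by
  intro I
  have h := hA.integrable _ _ (isSmoothVectorField_mulInvariantVectorField u)
    (isSmoothVectorField_mulInvariantVectorField v) 1
  simp only [apply_mulInvariantVectorField hinv] at h
  exact h

variable (Γ : Subgroup G) [DiscreteTopology Γ]

lemma LeftQuotient.apply_frame
    {A : (x : G) → TangentSpace 𝓘(ℝ, E) x →L[ℝ] TangentSpace 𝓘(ℝ, E) x}
    (hA : ∀ g : G, IsHolomorphicMap (fun x => g * x) A A)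
    {B : (x : LeftQuotient Γ) → TangentSpace 𝓘(ℝ, E) x →L[ℝ] TangentSpace 𝓘(ℝ, E) x}
    (hB : IsHolomorphicMap (LeftQuotient.mk Γ) A B) (p : LeftQuotient Γ)
    (v : GroupLieAlgebra 𝓘(ℝ, E) G) :
    B p (LeftQuotient.frame Γ p v) = LeftQuotient.frame Γ p (A 1 v) := by
  obtain ⟨g, rfl⟩ := LeftQuotient.mk_surjective Γ p
  rw [LeftQuotient.frame_mk, ← hB.2, apply_mulInvariantVectorField hA]
  exact (LeftQuotient.frame_mk Γ g _).symm

variable {Γ}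

lemma LeftQuotient.mdifferentiable_frame (v : GroupLieAlgebra 𝓘(ℝ, E) G) :
    MDifferentiable 𝓘(ℝ, E) 𝓘(ℝ, E).tangent
      (fun p => (⟨p, LeftQuotient.frame Γ p v⟩ : TangentBundle 𝓘(ℝ, E) (LeftQuotient Γ))) :=
  (LeftQuotient.contMDiff_frame Γ v).mdifferentiable (by simp)

/-- The connection form of a covariant derivative on `Γ \ G` in the left invariant framing. -/
noncomputable def LeftQuotient.connectionForm
    (nabla : CovariantDerivative 𝓘(ℝ, E) E (TangentSpace 𝓘(ℝ, E) : LeftQuotient Γ → Type _))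
    (p : LeftQuotient Γ) : GroupLieAlgebra 𝓘(ℝ, E) G →ₗ[ℝ]
      GroupLieAlgebra 𝓘(ℝ, E) G →ₗ[ℝ] GroupLieAlgebra 𝓘(ℝ, E) G :=
  LinearMap.mk₂ ℝ (fun u v => (LeftQuotient.frame Γ p).symm
      (nabla (fun q => LeftQuotient.frame Γ q v) p (LeftQuotient.frame Γ p u)))
    (fun u u' v => by rw [map_add, map_add, map_add])
    (fun r u v => by rw [map_smul, map_smul, map_smul])
    (fun u v v' => by
      have h := nabla.isCovariantDerivativeOn.add (s := univ)
        (LeftQuotient.mdifferentiable_frame v p) (LeftQuotient.mdifferentiable_frame v' p)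
      have h1 : (fun q => LeftQuotient.frame Γ q (v + v')) =
        (fun q => LeftQuotient.frame Γ q v) + fun q => LeftQuotient.frame Γ q v' :=
        funext fun q => map_add _ _ _
      rw [h1, h, add_apply, map_add])
    (fun r u v => by
      have h := nabla.isCovariantDerivativeOn.smul_const (s := univ) r
        (LeftQuotient.mdifferentiable_frame v p)
      have h1 : (fun q => LeftQuotient.frame Γ q (r • v)) =
        r • (fun q => LeftQuotient.frame Γ q v) := funext fun q => map_smul _ _ _
      rw [h1, h, smul_apply, map_smul])

lemma LeftQuotient.frame_connectionForm
    (nabla : CovariantDerivative 𝓘(ℝ, E) E (TangentSpace 𝓘(ℝ, E) : LeftQuotient Γ → Type _))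
    (p : LeftQuotient Γ) (u v : GroupLieAlgebra 𝓘(ℝ, E) G) :
    LeftQuotient.frame Γ p (LeftQuotient.connectionForm nabla p u v) =
      nabla (fun q => LeftQuotient.frame Γ q v) p (LeftQuotient.frame Γ p u) :=
  (LeftQuotient.frame Γ p).apply_symm_apply _

/-- In the frame `B` has the constant coefficients `A 1`, so `∇B = 0` reduces to commutation with
the connection form. -/
lemma LeftQuotient.connectionForm_comm
    {nabla : CovariantDerivative 𝓘(ℝ, E) E (TangentSpace 𝓘(ℝ, E) : LeftQuotient Γ → Type _)}
    {A : (x : G) → TangentSpace 𝓘(ℝ, E) x →L[ℝ] TangentSpace 𝓘(ℝ, E) x}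
    (hA : ∀ g : G, IsHolomorphicMap (fun x => g * x) A A)
    {B : (x : LeftQuotient Γ) → TangentSpace 𝓘(ℝ, E) x →L[ℝ] TangentSpace 𝓘(ℝ, E) x}
    (hB : IsHolomorphicMap (LeftQuotient.mk Γ) A B) (hp : IsParallelTensor nabla B)
    (p : LeftQuotient Γ) (u v : GroupLieAlgebra 𝓘(ℝ, E) G) :
    LeftQuotient.connectionForm nabla p u (A 1 v) =
      A 1 (LeftQuotient.connectionForm nabla p u v) := by
  refine (LeftQuotient.frame Γ p).injective ?_
  refine (LeftQuotient.frame_connectionForm nabla p u (A 1 v)).trans ?_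
  refine Eq.trans ?_ (LeftQuotient.apply_frame Γ hA hB p _)
  rw [LeftQuotient.frame_connectionForm, ← hp _ _ (LeftQuotient.mdifferentiable_frame v p)]
  have h1 : (fun q => LeftQuotient.frame Γ q (A 1 v)) =
      fun q => B q (LeftQuotient.frame Γ q v) :=
    funext fun q => (LeftQuotient.apply_frame Γ hA hB q v).symm
  exact DFunLike.congr_fun (congrArg (fun σ => nabla σ p) h1) _

lemma LeftQuotient.connectionForm_sub [FiniteDimensional ℝ E] [CompleteSpace E]
    {nabla : CovariantDerivative 𝓘(ℝ, E) E (TangentSpace 𝓘(ℝ, E) : LeftQuotient Γ → Type _)}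
    (h : nabla.torsion = 0) (p : LeftQuotient Γ) (u v : GroupLieAlgebra 𝓘(ℝ, E) G) :
    LeftQuotient.connectionForm nabla p u v - LeftQuotient.connectionForm nabla p v u =
      ⁅u, v⁆ := by
  refine (LeftQuotient.frame Γ p).injective ?_
  have h1 := nabla.torsion_apply (LeftQuotient.mdifferentiable_frame u p)
    (LeftQuotient.mdifferentiable_frame v p)
  rw [LeftQuotient.mlieBracket_frame, h, ← LeftQuotient.frame_connectionForm,
    ← LeftQuotient.frame_connectionForm] at h1
  exact (map_sub _ _ _).trans (sub_eq_zero.mp h1.symm)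

/-- The algebraic trace argument applies at each point `p` separately, so the connection form need
not be known to be independent of `p`. -/
theorem LeftQuotient.trace_connectionForm [FiniteDimensional ℝ E] [Group.IsNilpotent G]
    {S : HypercomplexStructure E G} (hS : S.IsLeftInvariant)
    {S' : HypercomplexStructure E (LeftQuotient Γ)}
    (hS' : S.IsHypercomplexMap S' (LeftQuotient.mk Γ))
    {nabla : CovariantDerivative 𝓘(ℝ, E) E (TangentSpace 𝓘(ℝ, E) : LeftQuotient Γ → Type _)}
    (hnabla : IsObataConnection S' nabla) (p : LeftQuotient Γ) (u : GroupLieAlgebra 𝓘(ℝ, E) G) :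
    LinearMap.trace ℝ _ (LeftQuotient.connectionForm nabla p u) = 0 := by
  have hc : CompleteSpace E := FiniteDimensional.complete ℝ E
  have hfd : FiniteDimensional ℝ (GroupLieAlgebra 𝓘(ℝ, E) G) := ‹FiniteDimensional ℝ E›
  have hn : LieRing.IsNilpotent (GroupLieAlgebra 𝓘(ℝ, E) G) := GroupLieAlgebra.isNilpotent
  have hI := LeftQuotient.connectionForm_comm (fun g => (hS g).map_I) hS'.map_I hnabla.parallel_I
  have hJ := LeftQuotient.connectionForm_comm (fun g => (hS g).map_J) hS'.map_J hnabla.parallel_J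
  let I : GroupLieAlgebra 𝓘(ℝ, E) G →ₗ[ℝ] GroupLieAlgebra 𝓘(ℝ, E) G := (S.I 1).toLinearMap
  let J : GroupLieAlgebra 𝓘(ℝ, E) G →ₗ[ℝ] GroupLieAlgebra 𝓘(ℝ, E) G := (S.J 1).toLinearMap
  refine trace_eq_zero_of_torsion_free (I := I) (S.isComplexStructure_I.sq 1)
    (isComplexStructure_lie S.isComplexStructure_I fun g => (hS g).map_I)
    (LeftQuotient.connectionForm nabla p)
    (LeftQuotient.connectionForm_sub hnabla.torsion_free p) (hI p) (fun x => ?_) u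
  refine trace_mul_eq_zero_of_anticomm (J := J) (S.isComplexStructure_J.sq 1) (fun v => ?_) (hJ p x)
  exact (S.I_J 1 v).trans ((neg_eq_iff_eq_neg.mpr (S.J_I 1 v)).symm)

end ConnectionForm

/-! ### Coordinates of a curve in a moving basis. -/

section MovingBasis

variable {V W : Type*} [NormedAddCommGroup V] [NormedSpace ℝ V] [FiniteDimensional ℝ V]
  [NormedAddCommGroup W] [NormedSpace ℝ W]

lemma ContinuousLinearMap.eq_sum_smulRight (L : V →L[ℝ] W) :
    L = ∑ i, (LinearMap.toContinuousLinearMap ((Module.finBasis ℝ V).coord i)).smulRight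
      (L (Module.finBasis ℝ V i)) := by
  ext v
  conv_lhs => rw [← (Module.finBasis ℝ V).sum_repr v]
  simp only [map_sum, map_smul, FunLike.coe_sum, Finset.sum_apply,
    ContinuousLinearMap.smulRight_apply, LinearMap.coe_toContinuousLinearMap', Module.Basis.coord_apply]

lemma exists_hasDerivAt_of_apply {L : ℝ → V →L[ℝ] W} {D : V → W} {t : ℝ}
    (h : ∀ v, HasDerivAt (fun s => L s v) (D v) t) :
    ∃ L' : V →L[ℝ] W, HasDerivAt L L' t ∧ ∀ v, L' v = D v := by
  have h1 : HasDerivAt L (∑ i, (LinearMap.toContinuousLinearMap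
      ((Module.finBasis ℝ V).coord i)).smulRight (D (Module.finBasis ℝ V i))) t := by
    rw [funext fun s => (L s).eq_sum_smulRight]
    refine HasDerivAt.fun_sum fun i _ => ?_
    exact (ContinuousLinearMap.smulRightL ℝ V W _).hasFDerivAt.comp_hasDerivAt t (h _)
  refine ⟨_, h1, fun v => ?_⟩
  exact (((ContinuousLinearMap.apply ℝ W v).hasFDerivAt.comp_hasDerivAt t h1)).unique (h v)

lemma continuousAt_of_apply {X : Type*} [TopologicalSpace X] {L : X → V →L[ℝ] W} {t : X}
    (h : ∀ v, ContinuousAt (fun s => L s v) t) : ContinuousAt L t := by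
  rw [funext fun s => (L s).eq_sum_smulRight]
  refine tendsto_finsetSum _ fun i _ => ?_
  exact ((ContinuousLinearMap.smulRightL ℝ V W _).continuous.tendsto _).comp (h _)

/-- Differentiate `w = L⁻¹ y`; since `(L⁻¹)' = -L⁻¹ L' L⁻¹`, the result is `L⁻¹ (y' - L' w)`. -/
lemma hasDerivAt_of_moving_basis {L : ℝ → V →L[ℝ] V} {D : V → V} {w y : ℝ → V} {w' y' : V} {t : ℝ}
    (hL : ∀ v, HasDerivAt (fun s => L s v) (D v) t) (hu : IsUnit (L t)) (hy : HasDerivAt y y' t)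
    (hw : ∀ᶠ s in 𝓝 t, L s (w s) = y s) (hw' : L t w' = y' - D (w t)) : HasDerivAt w w' t := by
  obtain ⟨L', hL', hD⟩ := exists_hasDerivAt_of_apply hL
  obtain ⟨U, hU⟩ := hu
  have hi : HasDerivAt (fun s => Ring.inverse (L s))
      (-ContinuousLinearMap.mulLeftRight ℝ (V →L[ℝ] V) ↑U⁻¹ ↑U⁻¹ L') t :=
    HasFDerivAt.comp_hasDerivAt t (f := L) (l := Ring.inverse)
      (l' := -ContinuousLinearMap.mulLeftRight ℝ (V →L[ℝ] V) ↑U⁻¹ ↑U⁻¹)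
      (by rw [← hU]; exact hasFDerivAt_ringInverse U) hL'
  have hUU : ∀ v, (↑U⁻¹ : V →L[ℝ] V) (L t v) = v := fun v => by
    have := DFunLike.congr_fun U.inv_mul v
    rw [← hU]; exact this
  have hev : ∀ᶠ s in 𝓝 t, IsUnit (L s) :=
    hL'.continuousAt.eventually (Units.isOpen.mem_nhds ⟨U, hU⟩)
  have heq : w =ᶠ[𝓝 t] fun s => Ring.inverse (L s) (y s) := by
    filter_upwards [hev, hw] with s hs hws
    rw [← hws]
    exact (DFunLike.congr_fun (Ring.inverse_mul_cancel _ hs) (w s)).symm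
  refine ((hi.clm_apply hy).congr_of_eventuallyEq heq).congr_deriv ?_
  have h1 : (↑U⁻¹ : V →L[ℝ] V) (y t) = w t := by rw [← hw.self_of_nhds, hUU]
  rw [← hUU w', hw', ← hU, Ring.inverse_unit, ← hD, ← h1]
  simp only [neg_apply, ContinuousLinearMap.mulLeftRight_apply,
    mul_apply_eq_comp, map_sub]
  abel

lemma continuousAt_of_moving_basis {X : Type*} [TopologicalSpace X] {L : X → V →L[ℝ] V}
    {w y : X → V} {t : X} (hL : ∀ v, ContinuousAt (fun s => L s v) t) (hu : IsUnit (L t))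
    (hy : ContinuousAt y t) (hw : ∀ᶠ s in 𝓝 t, L s (w s) = y s) : ContinuousAt w t := by
  have hc := continuousAt_of_apply hL
  obtain ⟨U, hU⟩ := hu
  have hi : ContinuousAt (fun s => Ring.inverse (L s)) t :=
    ContinuousAt.comp (g := Ring.inverse)
      (by rw [← hU]; exact NormedRing.inverse_continuousAt U) hc
  have hev : ∀ᶠ s in 𝓝 t, IsUnit (L s) :=
    hc.eventually (Units.isOpen.mem_nhds ⟨U, hU⟩)
  refine (hi.clm_apply hy).congr ?_
  filter_upwards [hev, hw] with s hs hws
  rw [← hws]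
  exact DFunLike.congr_fun (Ring.inverse_mul_cancel _ hs) (w s)

end MovingBasis

/-! ### Covariant derivatives in a local trivialization. -/

section Coordinates

open Bundle

variable {E : Type*} [NormedAddCommGroup E] [NormedSpace ℝ E]
  {H : Type*} [TopologicalSpace H] {I : ModelWithCorners ℝ E H}
  {M : Type*} [TopologicalSpace M] [ChartedSpace H M]
  {F : Type*} [NormedAddCommGroup F] [NormedSpace ℝ F]
  {V : M → Type*} [TopologicalSpace (TotalSpace F V)] [∀ x, AddCommGroup (V x)]
  [∀ x, Module ℝ (V x)] [∀ x, TopologicalSpace (V x)] [FiberBundle F V] [VectorBundle ℝ F V]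

variable (F) in
/-- The coordinates of a section in the preferred trivialization at `p`. -/
noncomputable def sectionCoord (p : M) (σ : (x : M) → V x) (q : M) : F :=
  (trivializationAt F V p).continuousLinearMapAt ℝ q (σ q)

lemma sectionCoord_eventuallyEq (p : M) (σ : (x : M) → V x) :
    sectionCoord F p σ =ᶠ[𝓝 p] fun q => (trivializationAt F V p ⟨q, σ q⟩).2 := by
  filter_upwards [(trivializationAt F V p).open_baseSet.mem_nhds
    (FiberBundle.mem_baseSet_trivializationAt' p)] with q hq
  exact (trivializationAt F V p).continuousLinearMapAt_apply_of_mem ℝ hq _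

lemma mdifferentiableAt_sectionCoord {p : M} {σ : (x : M) → V x}
    (hσ : MDifferentiableAt I (I.prod 𝓘(ℝ, F)) (fun x => TotalSpace.mk' F x (σ x)) p) :
    MDifferentiableAt I 𝓘(ℝ, F) (sectionCoord F p σ) p :=
  ((mdifferentiableAt_section (IB := I) σ).mp hσ).congr_of_eventuallyEq
    (sectionCoord_eventuallyEq p σ)

lemma mvfderiv_sectionCoord_extend (p : M) (v : V p) :
    mvfderiv I (sectionCoord F p (FiberBundle.extend F v)) p = 0 := by
  have h : sectionCoord F p (FiberBundle.extend F v) =ᶠ[𝓝 p]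
      fun _ => (trivializationAt F V p ⟨p, v⟩).2 := by
    filter_upwards [(trivializationAt F V p).open_baseSet.mem_nhds
      (FiberBundle.mem_baseSet_trivializationAt' p)] with q hq
    exact (trivializationAt F V p).linearMapAt_symm (R := ℝ) hq _
  have h1 : HasMFDerivAt I 𝓘(ℝ, F) (sectionCoord F p (FiberBundle.extend F v)) p
      (0 : E →L[ℝ] F) :=
    (hasMFDerivAt_const (trivializationAt F V p ⟨p, v⟩).2 p).congr_of_eventuallyEq h
  rw [mvfderiv, h1.mfderiv]
  exact ContinuousLinearMap.comp_zero _

variable [∀ x, IsTopologicalAddGroup (V x)] [∀ x, ContinuousSMul ℝ (V x)]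
  [FiniteDimensional ℝ F] [ContMDiffVectorBundle 1 F V I]

/-- The local expression of a covariant derivative: its difference with the trivial connection of
a trivialization is a tensor. -/
lemma continuousLinearMapAt_covariantDerivative (nabla : CovariantDerivative I F V) {p : M}
    {σ : (x : M) → V x}
    (hσ : MDifferentiableAt I (I.prod 𝓘(ℝ, F)) (fun x => TotalSpace.mk' F x (σ x)) p)
    (u : TangentSpace I p) :
    (trivializationAt F V p).continuousLinearMapAt ℝ p (nabla σ p u) =
      mvfderiv I (sectionCoord F p σ) p u +
      (trivializationAt F V p).continuousLinearMapAt ℝ p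
        (nabla (FiberBundle.extend F (σ p)) p u) := by
  let Φ : ((x : M) → V x) → F := fun σ =>
    (trivializationAt F V p).continuousLinearMapAt ℝ p (nabla σ p u) -
      mvfderiv I (sectionCoord F p σ) p u
  have hΦ : TensorialAt I F Φ p := by
    refine ⟨fun {f σ} hf hσ => ?_, fun {σ σ'} hσ hσ' => ?_⟩
    · have h1 : sectionCoord F p (f • σ) = f • sectionCoord F p σ := funext fun q => map_smul _ _ _
      simp only [Φ]
      rw [h1, nabla.isCovariantDerivativeOn.leibniz (s := univ) hσ hf,
        mvfderiv_smul hf (mdifferentiableAt_sectionCoord hσ)]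
      simp only [add_apply, smul_apply, ContinuousLinearMap.smulRight_apply, map_add, map_smul,
        sectionCoord, smul_sub]
      abel
    · have h1 : sectionCoord F p (σ + σ') = sectionCoord F p σ + sectionCoord F p σ' :=
        funext fun q => map_add _ _ _
      simp only [Φ]
      rw [h1, nabla.isCovariantDerivativeOn.add (s := univ) hσ hσ',
        mvfderiv_add (mdifferentiableAt_sectionCoord hσ) (mdifferentiableAt_sectionCoord hσ')]
      simp only [add_apply, map_add]
      abel
  -- By tensoriality `σ` may be exchanged for the extension of its value at `p`, whose coordinates
  -- are constant near `p`.
  have h := hΦ.pointwise hσ (FiberBundle.mdifferentiableAt_extend I F (σ p))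
    (FiberBundle.extend_apply_self F (σ p)).symm
  simp only [Φ, mvfderiv_sectionCoord_extend, zero_apply, sub_zero] at h
  exact sub_eq_iff_eq_add'.mp h

end Coordinates

/-! ### Parallel transport in the left-invariant frame. -/

section ParallelTransport

open Bundle VectorField

variable {E : Type*} [NormedAddCommGroup E] [NormedSpace ℝ E]
  {G : Type*} [Group G] [TopologicalSpace G] [ChartedSpace E G] [LieGroup 𝓘(ℝ, E) ∞ G]
  {Γ : Subgroup G} [DiscreteTopology Γ]

/-- The coordinates of a tangent vector of `Γ \ G` in the left invariant framing. -/
noncomputable def LeftQuotient.frameCoord (z : TangentBundle 𝓘(ℝ, E) (LeftQuotient Γ)) : E :=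
  (LeftQuotient.frame Γ z.proj).symm z.2

variable (E) in
/-- The left invariant framing in the preferred trivialization at `p`. -/
noncomputable def LeftQuotient.frameMatrix (p q : LeftQuotient Γ) : E →L[ℝ] E :=
  ((trivializationAt E (TangentSpace 𝓘(ℝ, E)) p).continuousLinearMapAt ℝ q).comp
    (LeftQuotient.frame (E := E) Γ q).toContinuousLinearMap

lemma LeftQuotient.isUnit_frameMatrix (p : LeftQuotient Γ) :
    IsUnit (LeftQuotient.frameMatrix E p p) := by
  let e : E ≃L[ℝ] E := (LeftQuotient.frame (E := E) Γ p).trans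
    ((trivializationAt E (TangentSpace 𝓘(ℝ, E)) p).continuousLinearEquivAt ℝ p
      (FiberBundle.mem_baseSet_trivializationAt' p))
  have h : LeftQuotient.frameMatrix E p p = (e : E →L[ℝ] E) := by
    refine ContinuousLinearMap.ext fun v => ?_
    exact (trivializationAt E (TangentSpace 𝓘(ℝ, E)) p).continuousLinearMapAt_apply_of_mem ℝ
      (FiberBundle.mem_baseSet_trivializationAt' p) _
  rw [h]
  exact (ContinuousLinearEquiv.unitsEquiv ℝ E |>.symm e).isUnit

lemma LeftQuotient.frameMatrix_frameCoord (p : LeftQuotient Γ)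
    (z : TangentBundle 𝓘(ℝ, E) (LeftQuotient Γ))
    (hz : z.proj ∈ (trivializationAt E (TangentSpace 𝓘(ℝ, E)) p).baseSet) :
    LeftQuotient.frameMatrix E p z.proj (LeftQuotient.frameCoord z) =
      (trivializationAt E (TangentSpace 𝓘(ℝ, E)) p z).2 := by
  refine ((trivializationAt E (TangentSpace 𝓘(ℝ, E)) p).continuousLinearMapAt_apply_of_mem ℝ
      hz _).trans ?_
  exact congrArg (fun v => (trivializationAt E (TangentSpace 𝓘(ℝ, E)) p
    (⟨z.proj, v⟩ : TangentBundle 𝓘(ℝ, E) (LeftQuotient Γ))).2)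
    ((LeftQuotient.frame Γ z.proj).apply_symm_apply z.2)

lemma LeftQuotient.mdifferentiableAt_frameMatrix (p : LeftQuotient Γ) (v : E) :
    MDifferentiableAt 𝓘(ℝ, E) 𝓘(ℝ, E) (fun q => LeftQuotient.frameMatrix E p q v) p :=
  mdifferentiableAt_sectionCoord (LeftQuotient.mdifferentiable_frame v p)

lemma LeftQuotient.continuous_frameCoord [FiniteDimensional ℝ E] [CompleteSpace E] :
    Continuous (LeftQuotient.frameCoord :
      TangentBundle 𝓘(ℝ, E) (LeftQuotient Γ) → E) := by
  refine continuous_iff_continuousAt.mpr fun z => ?_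
  have hp : Continuous (TotalSpace.proj : TangentBundle 𝓘(ℝ, E) (LeftQuotient Γ) → _) :=
    FiberBundle.continuous_proj E _
  refine continuousAt_of_moving_basis
    (L := fun z' => LeftQuotient.frameMatrix E z.proj z'.proj)
    (y := fun z' => (trivializationAt E (TangentSpace 𝓘(ℝ, E)) z.proj z').2)
    (fun v => ?_) (LeftQuotient.isUnit_frameMatrix z.proj) ?_ ?_
  · exact ContinuousAt.comp (f := TotalSpace.proj)
      (g := fun q => LeftQuotient.frameMatrix E z.proj q v)
      (LeftQuotient.mdifferentiableAt_frameMatrix z.proj v).continuousAt hp.continuousAt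
  · exact continuousAt_snd.comp
      ((trivializationAt E (TangentSpace 𝓘(ℝ, E)) z.proj).continuousAt
        ((trivializationAt E (TangentSpace 𝓘(ℝ, E)) z.proj).mem_source.mpr
          (FiberBundle.mem_baseSet_trivializationAt' z.proj)))
  · filter_upwards [hp.continuousAt.eventually
      ((trivializationAt E (TangentSpace 𝓘(ℝ, E)) z.proj).open_baseSet.mem_nhds
      (FiberBundle.mem_baseSet_trivializationAt' z.proj))] with z' hz'
    exact LeftQuotient.frameMatrix_frameCoord z.proj z' hz'

/-- The equation of parallel transport in the left invariant framing. -/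
lemma LeftQuotient.hasDerivAt_frameCoord [FiniteDimensional ℝ E] [CompleteSpace E]
    {nabla : CovariantDerivative 𝓘(ℝ, E) E (TangentSpace 𝓘(ℝ, E) : LeftQuotient Γ → Type _)}
    {W : ℝ → TangentBundle 𝓘(ℝ, E) (LeftQuotient Γ)} {t : ℝ} (hW : IsParallelAt nabla W t)
    (hγ : MDifferentiableAt 𝓘(ℝ, ℝ) 𝓘(ℝ, E) (fun s => (W s).proj) t) :
    HasDerivAt (F := E) (fun s => LeftQuotient.frameCoord (E := E) (W s))
      (@Neg.neg E _ (LeftQuotient.connectionForm nabla (W t).proj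
        ((LeftQuotient.frame (E := E) Γ (W t).proj).symm
          (mfderiv 𝓘(ℝ, ℝ) 𝓘(ℝ, E) (fun s => (W s).proj) t (1 : ℝ)))
        (LeftQuotient.frameCoord (E := E) (W t)))) t := by
  set u := mfderiv 𝓘(ℝ, ℝ) 𝓘(ℝ, E) (fun s => (W s).proj) t (1 : ℝ) with hu
  have hb := FiberBundle.mem_baseSet_trivializationAt' (F := E)
    (E := (TangentSpace 𝓘(ℝ, E) : LeftQuotient Γ → Type _)) (W t).proj
  refine hasDerivAt_of_moving_basis (V := E)
    (L := fun s => LeftQuotient.frameMatrix E (W t).proj (W s).proj)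
    (D := fun v : E => mvfderiv 𝓘(ℝ, E) (sectionCoord E (W t).proj
      (fun q => LeftQuotient.frame (E := E) Γ q v)) (W t).proj u)
    (fun v => ?_) (LeftQuotient.isUnit_frameMatrix (W t).proj) hW ?_ ?_
  · have h1 := (LeftQuotient.mdifferentiableAt_frameMatrix (W t).proj v).hasMFDerivAt.comp t
      hγ.hasMFDerivAt
    let c : ℝ →L[ℝ] E := mfderiv 𝓘(ℝ, ℝ) 𝓘(ℝ, E) (fun s => (W s).proj) t
    let A : E →L[ℝ] E := mfderiv 𝓘(ℝ, E) 𝓘(ℝ, E)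
      (fun q => LeftQuotient.frameMatrix E (W t).proj q v) (W t).proj
    have h2 : HasFDerivAt (fun s => LeftQuotient.frameMatrix E (W t).proj (W s).proj v)
      (A.comp c) t := h1.hasFDerivAt
    exact h2.hasDerivAt
  · filter_upwards [hγ.continuousAt.eventually
      ((trivializationAt E (TangentSpace 𝓘(ℝ, E)) (W t).proj).open_baseSet.mem_nhds hb)] with s hs
    exact LeftQuotient.frameMatrix_frameCoord _ _ hs
  -- The frame field with the coefficients of `W t` frozen is differentiated in the trivialization.
  -- Its covariant derivative is `D` plus the term that `IsParallelAt` equates with `-y'`, which is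
  -- the required relation `L w' = y' - D w`.
  · have h1 := continuousLinearMapAt_covariantDerivative nabla
      (LeftQuotient.mdifferentiable_frame (LeftQuotient.frameCoord (E := E) (W t)) (W t).proj) u
    have h2 : LeftQuotient.frame (E := E) Γ (W t).proj (LeftQuotient.frameCoord (E := E) (W t)) = (W t).2 :=
      (LeftQuotient.frame (E := E) Γ (W t).proj).apply_symm_apply _
    have h3 : LeftQuotient.frameMatrix E (W t).proj (W t).proj
        (LeftQuotient.connectionForm nabla (W t).proj ((LeftQuotient.frame (E := E) Γ (W t).proj).symm u)
        (LeftQuotient.frameCoord (E := E) (W t))) =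
        (trivializationAt E (TangentSpace 𝓘(ℝ, E)) (W t).proj).continuousLinearMapAt ℝ (W t).proj
          (nabla (fun q => LeftQuotient.frame (E := E) Γ q (LeftQuotient.frameCoord (E := E) (W t)))
            (W t).proj u) := by
      refine congrArg ((trivializationAt E (TangentSpace 𝓘(ℝ, E)) (W t).proj).continuousLinearMapAt
        ℝ (W t).proj) ?_
      refine (LeftQuotient.frame_connectionForm nabla _ _ _).trans ?_
      rw [ContinuousLinearEquiv.apply_symm_apply]
    have h4 := (trivializationAt E (TangentSpace 𝓘(ℝ, E))
      (W t).proj).continuousLinearMapAt_apply_of_mem ℝ hb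
        (nabla (FiberBundle.extend E (W t).snd) (W t).proj u)
    rw [h2, h4] at h1
    refine (map_neg (LeftQuotient.frameMatrix E (W t).proj (W t).proj) _).trans ?_
    refine (congrArg Neg.neg (h3.trans h1)).trans ?_
    exact (neg_add_rev _ _).trans (sub_eq_add_neg _ _).symm

end ParallelTransport

/-! ### Holonomy of loops. -/

section Holonomy

open Bundle VectorField

variable {E : Type*} [NormedAddCommGroup E] [NormedSpace ℝ E]
  {G : Type*} [Group G] [TopologicalSpace G] [ChartedSpace E G] [LieGroup 𝓘(ℝ, E) ∞ G]
  {Γ : Subgroup G} [DiscreteTopology Γ]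

/-- The connection form evaluated on the velocity of a curve. -/
noncomputable def LeftQuotient.connectionAlong
    (nabla : CovariantDerivative 𝓘(ℝ, E) E (TangentSpace 𝓘(ℝ, E) : LeftQuotient Γ → Type _))
    (γ : ℝ → LeftQuotient Γ) (t : ℝ) :
    GroupLieAlgebra 𝓘(ℝ, E) G →ₗ[ℝ] GroupLieAlgebra 𝓘(ℝ, E) G :=
  LeftQuotient.connectionForm nabla (γ t) ((LeftQuotient.frame (E := E) Γ (γ t)).symm
    (mfderiv 𝓘(ℝ, ℝ) 𝓘(ℝ, E) γ t (1 : ℝ)))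

lemma LeftQuotient.connectionAlong_congr
    (nabla : CovariantDerivative 𝓘(ℝ, E) E (TangentSpace 𝓘(ℝ, E) : LeftQuotient Γ → Type _))
    {γ γ' : ℝ → LeftQuotient Γ} {t : ℝ} (h : γ =ᶠ[𝓝 t] γ') :
    LeftQuotient.connectionAlong nabla γ t = LeftQuotient.connectionAlong nabla γ' t := by
  have key : ∀ (p q : LeftQuotient Γ), p = q → ∀ a b : E, a = b →
      LeftQuotient.connectionForm nabla p ((LeftQuotient.frame (E := E) Γ p).symm a) =
      LeftQuotient.connectionForm nabla q ((LeftQuotient.frame (E := E) Γ q).symm b) := by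
    rintro p _ rfl a _ rfl
    rfl
  refine key _ _ h.self_of_nhds _ _ ?_
  exact DFunLike.congr_fun (F := ℝ →L[ℝ] E) h.mfderiv_eq (1 : ℝ)

lemma IsPiecewiseC1Path.exists_mem_Ioo {M : Type*} [TopologicalSpace M] [ChartedSpace E M]
    {γ : ℝ → M} {k : ℕ} {τ : ℕ → ℝ} (hγ : IsPiecewiseC1Path (E := E) γ k τ) {s : ℝ}
    (hs : s ∈ Ioo (0 : ℝ) 1 \ range τ) :
    ∃ i < k, s ∈ Ioo (τ i) (τ (i + 1)) ∧ Ioo (τ i) (τ (i + 1)) ⊆ Icc 0 1 := by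
  classical
  -- The first break point beyond `s` has positive index because `τ 0 = 0 < s`; its predecessor is
  -- strictly below `s` because `s` is not a break point.
  have hex : ∃ j, s < τ j := ⟨k, by rw [hγ.one]; exact hs.1.2⟩
  obtain ⟨i, hi⟩ : ∃ i, Nat.find hex = i + 1 := by
    refine Nat.exists_eq_succ_of_ne_zero fun h0 => ?_
    have := Nat.find_spec hex
    rw [h0, hγ.zero] at this
    exact this.not_gt hs.1.1
  have hik : i < k := by
    have := Nat.find_min' hex (show s < τ k by rw [hγ.one]; exact hs.1.2)
    omega
  refine ⟨i, hik, ⟨?_, hi ▸ Nat.find_spec hex⟩, fun r hr => ⟨?_, ?_⟩⟩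
  · refine lt_of_le_of_ne (not_lt.mp (Nat.find_min hex (by omega))) fun h => hs.2 ⟨i, h⟩
  · rw [← hγ.zero]
    exact (hγ.mono (Nat.zero_le i)).trans hr.1.le
  · rw [← hγ.one]
    exact hr.2.le.trans (hγ.mono hik)

lemma LeftQuotient.hasDerivAt_frameCoord_of_isParallelAlong [FiniteDimensional ℝ E]
    [CompleteSpace E]
    {nabla : CovariantDerivative 𝓘(ℝ, E) E (TangentSpace 𝓘(ℝ, E) : LeftQuotient Γ → Type _)}
    {γ : ℝ → LeftQuotient Γ} {k : ℕ} {τ : ℕ → ℝ} {W : ℝ → TangentBundle 𝓘(ℝ, E) (LeftQuotient Γ)}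
    (hγ : IsPiecewiseC1Path (E := E) γ k τ) (hW : IsParallelAlong nabla γ k τ W) {s : ℝ}
    (hs : s ∈ Ioo (0 : ℝ) 1 \ range τ) :
    HasDerivAt (F := E) (fun s => LeftQuotient.frameCoord (W s))
      (@Neg.neg E _ (LeftQuotient.connectionAlong nabla γ s
        (LeftQuotient.frameCoord (E := E) (W s)))) s := by
  obtain ⟨i, hi, hsi, hsub⟩ := hγ.exists_mem_Ioo hs
  have h1 : (fun s => (W s).proj) =ᶠ[𝓝 s] γ := by
    filter_upwards [Ioo_mem_nhds hsi.1 hsi.2] with r hr using hW.proj_eq r (hsub hr)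
  have h2 : MDifferentiableAt 𝓘(ℝ, ℝ) 𝓘(ℝ, E) γ s :=
    ((hγ.contMDiffOn i hi).contMDiffAt (Icc_mem_nhds hsi.1 hsi.2)).mdifferentiableAt (by simp)
  have h3 := LeftQuotient.hasDerivAt_frameCoord (hW.parallel i hi s hsi)
    (h2.congr_of_eventuallyEq h1)
  rw [← LeftQuotient.connectionAlong_congr nabla h1]
  exact h3

lemma LeftQuotient.isLoopTransport_mem_quaternionicSL [FiniteDimensional ℝ E]
    [Group.IsNilpotent G] {S : HypercomplexStructure E G} (hS : S.IsLeftInvariant)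
    {S' : HypercomplexStructure E (LeftQuotient Γ)}
    (hS' : S.IsHypercomplexMap S' (LeftQuotient.mk Γ))
    {nabla : CovariantDerivative 𝓘(ℝ, E) E (TangentSpace 𝓘(ℝ, E) : LeftQuotient Γ → Type _)}
    (hnabla : IsObataConnection S' nabla) {x : LeftQuotient Γ}
    {h : TangentSpace 𝓘(ℝ, E) x ≃ₗ[ℝ] TangentSpace 𝓘(ℝ, E) x} (hh : IsLoopTransport nabla x h) :
    h ∈ quaternionicSL (S'.I x).toLinearMap (S'.J x).toLinearMap (S'.K x).toLinearMap := by
  have hc : CompleteSpace E := FiniteDimensional.complete ℝ E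
  obtain ⟨γ, k, τ, hγ, h0, h1, hW⟩ := hh
  choose W hW hW0 hW1 using hW
  let e := (LeftQuotient.frame (E := E) Γ x).toLinearEquiv
  -- The frame at `x` carries the equation from `𝔤` to the fixed space `T_x N`. A parallel field
  -- starts and ends over `x`, where `e` inverts `frameCoord`, so `h` is the time-one map of this
  -- equation.
  let B : ℝ → TangentSpace 𝓘(ℝ, E) x →ₗ[ℝ] TangentSpace 𝓘(ℝ, E) x := fun s =>
    e.conj (-LeftQuotient.connectionAlong nabla γ s)
  have hB : ∀ s v, B s v = -e (LeftQuotient.connectionAlong nabla γ s (e.symm v)) :=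
    fun s v => map_neg e _
  have hcomm : ∀ {A : (x : G) → TangentSpace 𝓘(ℝ, E) x →L[ℝ] TangentSpace 𝓘(ℝ, E) x}
      (_ : ∀ g : G, IsHolomorphicMap (fun x => g * x) A A)
      {A' : (x : LeftQuotient Γ) → TangentSpace 𝓘(ℝ, E) x →L[ℝ] TangentSpace 𝓘(ℝ, E) x}
      (_ : IsHolomorphicMap (LeftQuotient.mk Γ) A A') (_ : IsParallelTensor nabla A') (s : ℝ)
      (v : TangentSpace 𝓘(ℝ, E) x), B s (A' x v) = A' x (B s v) := by
    intro A hA A' hA' hp s v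
    have h2 : e.symm (A' x v) = A 1 (e.symm v) := by
      refine e.injective ?_
      refine (e.apply_symm_apply _).trans ?_
      refine Eq.trans ?_ (LeftQuotient.apply_frame Γ hA hA' x (e.symm v))
      exact congrArg (A' x) (e.apply_symm_apply v).symm
    rw [hB, hB, h2, map_neg]
    refine congrArg Neg.neg ?_
    refine Eq.trans ?_ (LeftQuotient.apply_frame Γ hA hA' x _).symm
    exact congrArg e (LeftQuotient.connectionForm_comm hA hA' hp (γ s) _ (e.symm v))
  refine mem_quaternionicSL_of_hasDerivAt (V := E) (B := B) (h := h)
    (w := fun v s => e (LeftQuotient.frameCoord (E := E) (W v s)))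
    (S'.isComplexStructure_I.sq x) (S'.isComplexStructure_J.sq x) (S'.I_J x) (S'.J_I x)
    (countable_range τ) (fun v => ?_) (fun v => ?_) (fun v => ?_) (fun v s hs => ?_)
    (fun s _ => hcomm (fun g => (hS g).map_I) hS'.map_I hnabla.parallel_I s)
    (fun s _ => hcomm (fun g => (hS g).map_J) hS'.map_J hnabla.parallel_J s) (fun s _ => ?_)
  · exact (LeftQuotient.frame (E := E) Γ x).continuous.comp_continuousOn
      ((LeftQuotient.continuous_frameCoord (E := E)).comp_continuousOn (hW v).continuousOn)
  · exact (congrArg (fun z => e (LeftQuotient.frameCoord (E := E) z)) (hW0 v)).trans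
      (e.apply_symm_apply v)
  · exact (congrArg (fun z => e (LeftQuotient.frameCoord (E := E) z)) (hW1 v)).trans
      (e.apply_symm_apply (h v))
  · let L : E →L[ℝ] E := (LeftQuotient.frame (E := E) Γ x).toContinuousLinearMap
    have h2 := L.hasFDerivAt.comp_hasDerivAt s
      (LeftQuotient.hasDerivAt_frameCoord_of_isParallelAlong hγ (hW v) hs)
    refine HasDerivAt.congr_deriv h2 ?_
    refine (map_neg L _).trans (Eq.trans ?_ (hB s _).symm)
    refine congrArg (fun y => -e (LeftQuotient.connectionAlong nabla γ s y)) ?_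
    exact (e.symm_apply_apply _).symm
  · refine (LinearMap.trace_conj' _ e).trans ?_
    rw [map_neg]
    exact neg_eq_zero.mpr (LeftQuotient.trace_connectionForm hS hS' hnabla _ _)

end Holonomy

theorem mainTheorem3 {E : Type*} [NormedAddCommGroup E] [NormedSpace ℝ E] [FiniteDimensional ℝ E]
    {G : Type*} [Group G] [TopologicalSpace G] [T2Space G] [ChartedSpace E G]
    [LieGroup 𝓘(ℝ, E) ∞ G] [SimplyConnectedSpace G] [Group.IsNilpotent G]
    (Γ : Subgroup G) [DiscreteTopology Γ] [CompactSpace (LeftQuotient Γ)]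
    (S : HypercomplexStructure E G) (hS : S.IsLeftInvariant)
    (S' : HypercomplexStructure E (LeftQuotient Γ))
    (hS' : S.IsHypercomplexMap S' (LeftQuotient.mk Γ))
    (nabla : CovariantDerivative 𝓘(ℝ, E) E (TangentSpace 𝓘(ℝ, E) : LeftQuotient Γ → Type _))
    (hnabla : IsObataConnection S' nabla) (x : LeftQuotient Γ) :
    holonomyGroup nabla x ≤
      quaternionicSL (S'.I x).toLinearMap (S'.J x).toLinearMap (S'.K x).toLinearMap :=
  (Subgroup.closure_le _).mpr fun _ hh =>
    LeftQuotient.isLoopTransport_mem_quaternionicSL hS hS' hnabla hh
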